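/- **Setting.** Let $(\mathsf X,\mathcal X)$ and $(\mathsf Y,\mathcal Y)$ be arbitrary measurable spaces, $\mathsf Z=\mathsf X\times\mathsf Y$ with the product $\sigma$-field, and let $(\Theta,d)$ be a compact metric space with its Borel $\sigma$-field. Let $\mu$, $\nu$ be $\sigma$-finite measures on $\mathsf X$, $\mathsf Y$, and let $(Q_\theta)_{\theta\in\Theta}$ be Markov transition kernels on $\mathsf Z$ such that $Q_\theta(z,dz')=q_\theta(z,z')\,(\mu\otimes\nu)(dz')$ for all $\theta,z$, where $(\theta,z,z')\mapsto q_\theta(z,z')\ge 0$ is measurable on $\Theta\times\mathsf Z^2$. (This is a fully dominated partially observed Markov model.) For a probability measure $\eta$ on $\mathsf Z$, let $\mathbb P^\theta_\eta$ be the law on $\mathsf Z^{\mathbb N}$ of the canonical Markov chain $Z_n=(X_n,Y_n)$, $n\ge 0$, with transition kernel $Q_\theta$ and initial distribution $\eta$. Only $Y_1,Y_2,\dots$ are observed; put $Y_{1:n}=(Y_1,\dots,Y_n)$, $\mathcal F_n=\sigma(Y_{1:n})$ and, with $z_\ell=(x_\ell,y_\ell)$ for $\ell\ge 1$, $$p_{\theta,\eta}(y_{1:n})=\int\!\!\int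 \prod_{\ell=0}^{n-1} q_\theta(z_\ell,z_{\ell+1})\,\mu^{\otimes n}(dx_{1:n})\,\eta(dz_0).$$ Let $\lambda$ be a finite measure on $\Theta$ (the prior) and let $\eta$ be an arbitrary probability measure on $\mathsf Z$. The posterior is $$\lambda_\eta\langle y_{1:n}\rangle(A)=\frac{\int_A p_{\theta,\eta}(y_{1:n})\,\lambda(d\theta)}{\int_\Theta p_{\theta,\eta}(y_{1:n})\,\lambda(d\theta)},\qquad A\subseteq\Theta \text{ Borel}.$$ Fix $\theta_\star\in\Theta$. **Assumptions.** (B1) For every $\theta\in\Theta$, $Q_\theta$ has a unique stationary probability distribution $\pi_\theta$. Write $\pi_\star=\pi_{\theta_\star}$. (B2) For every compact $K\subseteq\Theta$ with $\theta_\star\in K$, every $K$-valued sequence $(\hat\theta_n)_{n\ge 1}$, with each $\hat\theta_n$ being $\mathcal F_n$-measurable, for which there are real random $\epsilon_n$ such that, $\mathbb P^{\theta_\star}_{\pi_\star}$-a.s., $\epsilon_n\to 0$ and $$n^{-1}\log p_{\hat\theta_n,\eta}(Y_{1:n})\ \ge\ n^{-1}\log p_{\theta_\star,\pi_\star}(Y_{1:n})+\epsilon_n\qquad\text{for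 all } n\ge 1,$$ converges to $\theta_\star$, $\mathbb P^{\theta_\star}_{\pi_\star}$-a.s. (B3) For all $\theta\in\Theta$ and all $z\in\mathsf Z$, $q_\theta(z,z')>0$ for $\mu\otimes\nu$-almost every $z'$. (B4) For all $\delta>0$, $\lambda(\{\theta\in\Theta:\Delta(\theta_\star,\theta)\le\delta\})>0$, where $$\Delta(\theta_\star,\theta)=\mathbb E^{\theta_\star}_{\pi_\star}\big[\mathrm{KL}\big(Q_{\theta_\star}(Z_0,\cdot)\,\|\,Q_\theta(Z_0,\cdot)\big)\big]\in[0,\infty],$$ with $\mathrm{KL}(P\|R)=\int\log\frac{dP}{dR}\,dP$ if $P\ll R$ and $\mathrm{KL}(P\|R)=\infty$ otherwise. **Conclusion.** For every probability measure $\eta_\star$ on $\mathsf Z$, $\mathbb P^{\theta_\star}_{\eta_\star}$-almost surely, the posterior $\lambda_\eta\langle Y_{1:n}\rangle$ is a well-defined probability measure for all $n$ large enough and converges weakly to $\delta_{\theta_\star}$ as $n\to\infty$. -/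

import Mathlib

open MeasureTheory ProbabilityTheory Filter Topology
open scoped ENNReal

namespace POMM

universe u v w

/-- A parametrised family of fully dominated partially observed Markov models: Markov transition
kernels `Q θ` on `X × Y` whose laws `Q θ z` all have a density `q θ z` with respect to the product
of two σ-finite measures `μ` on `X` and `ν` on `Y`, the density being jointly measurable in
`(θ, z, z')`. -/
structure FullyDominated (Θ : Type u) (X : Type v) (Y : Type w)
    [MeasurableSpace Θ] [MeasurableSpace X] [MeasurableSpace Y] where
  μ : Measure X
  ν : Measure Y
  sigmaFinite_μ : SigmaFinite μ
  sigmaFinite_ν : SigmaFinite ν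
  Q : Θ → Kernel (X × Y) (X × Y)
  isMarkovKernel_Q : ∀ θ, IsMarkovKernel (Q θ)
  q : Θ → X × Y → X × Y → ℝ≥0∞
  measurable_q : Measurable (fun t : Θ × (X × Y) × (X × Y) => q t.1 t.2.1 t.2.2)
  Q_eq_withDensity : ∀ θ z, Q θ z = (μ.prod ν).withDensity (q θ z)

attribute [instance] FullyDominated.sigmaFinite_μ FullyDominated.sigmaFinite_ν
  FullyDominated.isMarkovKernel_Q

/-- `π` is a stationary distribution of `κ`, and the only one. -/
def IsUniqueStationaryLaw {Z : Type u} [MeasurableSpace Z] (κ : Kernel Z Z) (π : Measure Z) :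
    Prop :=
  IsProbabilityMeasure π ∧ κ.Invariant π ∧
    ∀ ρ : Measure Z, IsProbabilityMeasure ρ → κ.Invariant ρ → ρ = π

/-- The law on `Z^ℕ` of the canonical Markov chain `(Z_n)_{n ≥ 0}` with transition kernel `κ` and
initial distribution `η`: given `Z_0, …, Z_n`, the law of `Z_{n+1}` is `κ Z_n`. -/
noncomputable def chainLaw {Z : Type u} [MeasurableSpace Z] (κ : Kernel Z Z) [IsMarkovKernel κ]
    (η : Measure Z) : Measure (ℕ → Z) :=
  Kernel.trajMeasure (X := fun _ => Z) η
    (fun n => κ.comap (fun h : (i : Finset.Iic n) → Z => h ⟨n, Finset.mem_Iic.2 le_rfl⟩)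
      (measurable_pi_apply _))

/-- The vector `(Y_1, …, Y_n)` of the first `n` observations along a trajectory. -/
def obs {X : Type v} {Y : Type w} (n : ℕ) (ω : ℕ → X × Y) : Fin n → Y :=
  fun i => (ω (i + 1)).2

/-- The σ-field generated by `(Y_1, …, Y_n)`. -/
abbrev obsSigma (X : Type v) (Y : Type w) [MeasurableSpace Y] (n : ℕ) :
    MeasurableSpace (ℕ → X × Y) :=
  MeasurableSpace.comap (obs n) inferInstance

/-- Weak convergence of a sequence of measures which are probability measures from some rank on. -/
def ConvergesWeakly {Θ : Type u} [TopologicalSpace Θ] [MeasurableSpace Θ] [OpensMeasurableSpace Θ]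
    (ρ : ℕ → Measure Θ) (ρ' : ProbabilityMeasure Θ) : Prop :=
  ∃ σ : ℕ → ProbabilityMeasure Θ,
    (∀ᶠ n in atTop, (σ n : Measure Θ) = ρ n) ∧ Tendsto σ atTop (𝓝 ρ')

namespace FullyDominated

variable {Θ : Type u} {X : Type v} {Y : Type w}
  [MeasurableSpace Θ] [MeasurableSpace X] [MeasurableSpace Y]

/-- The law of the canonical chain with parameter `θ` and initial distribution `η`. -/
noncomputable def law (M : FullyDominated Θ X Y) (θ : Θ) (η : Measure (X × Y)) :
    Measure (ℕ → X × Y) :=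
  chainLaw (M.Q θ) η

/-- The likelihood of `(y_1, …, y_n)`:
`∫∫ ∏_{ℓ=0}^{n-1} q_θ(z_ℓ, z_{ℓ+1}) μ^{⊗n}(dx_{1:n}) η(dz_0)`, with `z_ℓ = (x_ℓ, y_ℓ)`, `ℓ ≥ 1`. -/
noncomputable def likelihood (M : FullyDominated Θ X Y) (η : Measure (X × Y)) (θ : Θ) {n : ℕ}
    (y : Fin n → Y) : ℝ≥0∞ :=
  ∫⁻ z₀, ∫⁻ x : Fin n → X,
    let z : Fin (n + 1) → X × Y := Fin.cons z₀ (fun i => (x i, y i))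
    ∏ i : Fin n, M.q θ (z i.castSucc) (z i.succ) ∂(Measure.pi fun _ => M.μ) ∂η

/-- The posterior `A ↦ ∫_A p_θ(y) λ(dθ) / ∫_Θ p_θ(y) λ(dθ)`. It is a probability measure when the
denominator lies in `(0, ∞)`, and the zero measure otherwise. -/
noncomputable def posterior (M : FullyDominated Θ X Y) (prior : Measure Θ) (η : Measure (X × Y))
    {n : ℕ} (y : Fin n → Y) : Measure Θ :=
  (∫⁻ θ, M.likelihood η θ y ∂prior)⁻¹ • prior.withDensity (fun θ => M.likelihood η θ y)

/-- The expected Kullback-Leibler divergence `E[KL(Q_{θ₀}(Z_0, ·) ‖ Q_θ(Z_0, ·))]` for the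
chain with parameter `θ₀` and initial distribution `π₀`. -/
noncomputable def expectedKL (M : FullyDominated Θ X Y) (π₀ : Measure (X × Y)) (θ₀ θ : Θ) :
    ℝ≥0∞ :=
  ∫⁻ ω, InformationTheory.klDiv (M.Q θ₀ (ω 0)) (M.Q θ (ω 0)) ∂(M.law θ₀ π₀)

/-- `T` is a sequence of approximate maximum likelihood estimators on `K`, for the likelihood
with initial distribution `η`: it is `K`-valued, each `T n` is a measurable function of
`(Y_1, …, Y_n)`, and
`n⁻¹ log p_{T n, η}(Y_1, …, Y_n) ≥ n⁻¹ log p_{θ₀, π₀}(Y_1, …, Y_n) + ε n` for all `n ≥ 1`,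
with `ε n → 0`, almost surely for the chain with parameter `θ₀` started from `π₀`. -/
def IsApproxMLE (M : FullyDominated Θ X Y) (η π₀ : Measure (X × Y)) (θ₀ : Θ) (K : Set Θ)
    (T : ℕ → (ℕ → X × Y) → Θ) : Prop :=
  (∀ n : ℕ, 1 ≤ n → ∀ ω, T n ω ∈ K) ∧
  (∀ n : ℕ, 1 ≤ n → Measurable[obsSigma X Y n] (T n)) ∧
  ∃ ε : ℕ → (ℕ → X × Y) → ℝ, ∀ᵐ ω ∂(M.law θ₀ π₀),
    (∀ n : ℕ, 1 ≤ n →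
      (((n : ℝ)⁻¹ : ℝ) : EReal) * (M.likelihood π₀ θ₀ (obs n ω)).log + ((ε n ω : ℝ) : EReal) ≤
        (((n : ℝ)⁻¹ : ℝ) : EReal) * (M.likelihood η (T n ω) (obs n ω)).log) ∧
    Tendsto (fun n => ε n ω) atTop (𝓝 0)

/-- On every compact set containing `θ₀`, all sequences of approximate maximum likelihood
estimators converge almost surely to `θ₀`. -/
def ApproxMLEConsistent [TopologicalSpace Θ] (M : FullyDominated Θ X Y) (η π₀ : Measure (X × Y))
    (θ₀ : Θ) : Prop :=
  ∀ K : Set Θ, IsCompact K → θ₀ ∈ K → ∀ T : ℕ → (ℕ → X × Y) → Θ,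
    M.IsApproxMLE η π₀ θ₀ K T → ∀ᵐ ω ∂(M.law θ₀ π₀), Tendsto (fun n => T n ω) atTop (𝓝 θ₀)

end FullyDominated

end POMM

/-! By (B3) one step of the chain, from any state, has a law equivalent to `μ ⊗ ν`. Hence almost
sure statements about times `≥ 1` do not depend on the initial law, and it suffices to work under
the stationary law `π⋆`. There the posterior mass of a compact set `C` away from `θ⋆` is a quotient
whose two parts are compared separately with `p = p_{θ⋆,π⋆}(Y_{1:n})`.

Denominator: for every `δ > 0` it eventually exceeds `exp(-δn) p`
(`ae_eventually_lintegral_likelihood_ge`). For fully observed states, positivity of the kernel makes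
the shift ergodic (`ergodic_shiftBy_chainLaw`), and a one-sided ergodic theorem
(`ae_bddBelow_birkhoffSum`) bounds the log-likelihood ratio of `θ⋆` to `θ` by `n` times a rate
slightly above `Δ(θ⋆, θ)`. By (B4) and Fubini this passes to the mixture over the prior. Once the
complete-data bound holds, the bound for the observations fails with probability at most `exp(-δn)`,
by integrating out the hidden states; Borel-Cantelli concludes.

Numerator: almost surely there is a random `k` such that it is eventually below `exp(-n/(k+1)) p`
(`ae_eventually_setLIntegral_likelihood_lt`). Assumption (B2) speaks only of adapted estimators, so
one is built. A counter holds the current level `k`; whenever the likelihood integrated over `C`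
reaches the threshold of level `k`, the estimator is a measurably selected point of `C` of almost
that likelihood and the level goes up, and otherwise it is `θ⋆`. Either the level tends to infinity
or the estimator is eventually `θ⋆`, so it is an approximate maximum likelihood estimator in both
cases. By (B2) it converges to `θ⋆`, so it leaves `C`: exceedances stop and the level freezes.

Taking `δ = 1/(2(k+1))` in the first bound makes the quotient decay exponentially. -/

namespace POMM

universe u v w

/-! ### Markov chains on sequence space: uniqueness of the law and the Markov property. -/

section MarkovChain

variable {Z : Type*} [MeasurableSpace Z]

/-- The shift of a sequence by `m` steps. -/
def shiftBy (m : ℕ) (x : ℕ → Z) : ℕ → Z := fun k => x (m + k)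

@[fun_prop]
lemma measurable_shiftBy (m : ℕ) : Measurable (shiftBy m : (ℕ → Z) → ℕ → Z) := by
  unfold shiftBy; fun_prop

/-- The kernel at time `n`, as a kernel on the history up to time `n`. -/
noncomputable def historyKernel (κ : Kernel Z Z) (n : ℕ) : Kernel (Finset.Iic n → Z) Z :=
  κ.comap (fun h : (i : Finset.Iic n) → Z => h ⟨n, Finset.mem_Iic.2 le_rfl⟩)
    (measurable_pi_apply _)

instance (κ : Kernel Z Z) [IsMarkovKernel κ] (n : ℕ) : IsMarkovKernel (historyKernel κ n) := by
  unfold historyKernel; infer_instance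

/-- The one-step Markov property, with transition kernel `κ`, of a measure on sequences. -/
def IsMarkovLaw (κ : Kernel Z Z) (ρ : Measure (ℕ → Z)) : Prop :=
  ∀ (n : ℕ) (F : (Finset.Iic n → Z) × Z → ℝ≥0∞), Measurable F →
    ∫⁻ x, F (Preorder.frestrictLe n x, x (n + 1)) ∂ρ =
      ∫⁻ x, ∫⁻ z, F (Preorder.frestrictLe n x, z) ∂κ (x n) ∂ρ

lemma measure_ext_frestrictLe {ρ₁ ρ₂ : Measure (ℕ → Z)} [IsFiniteMeasure ρ₁] [IsFiniteMeasure ρ₂]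
    (h : ∀ n, ρ₁.map (Preorder.frestrictLe n) = ρ₂.map (Preorder.frestrictLe n)) : ρ₁ = ρ₂ := by
  let P : (I : Finset ℕ) → Measure (I → Z) := fun I => ρ₂.map I.restrict
  have hP : IsProjectiveMeasureFamily (α := fun _ => Z) P := by
    intro I J hJI
    simp only [P]
    rw [Measure.map_map (Finset.measurable_restrict₂ (X := fun _ => Z) hJI) (by fun_prop)]
    rfl
  have hl2 : IsProjectiveLimit ρ₂ P := fun I => rfl
  have hl1 : IsProjectiveLimit ρ₁ P := (isProjectiveLimit_nat_iff hP ρ₁).2 h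
  exact hl1.unique hl2

/-- By induction on `n`: the kernel and the marginal on times `0, …, n` determine the marginal on
times `0, …, n + 1`, and these marginals determine the measure. -/
lemma IsMarkovLaw.ext {κ : Kernel Z Z} [IsMarkovKernel κ] {ρ₁ ρ₂ : Measure (ℕ → Z)}
    [IsFiniteMeasure ρ₁] [IsFiniteMeasure ρ₂] (h₁ : IsMarkovLaw κ ρ₁) (h₂ : IsMarkovLaw κ ρ₂)
    (h0 : ρ₁.map (fun x => x 0) = ρ₂.map (fun x => x 0)) : ρ₁ = ρ₂ := by
  have key : ∀ n, ρ₁.map (Preorder.frestrictLe n) = ρ₂.map (Preorder.frestrictLe n) := by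
    intro n
    induction n with
    | zero =>
      have : (Preorder.frestrictLe 0 : (ℕ → Z) → _) =
          (fun z (_ : Finset.Iic 0) => z) ∘ (fun x : ℕ → Z => x 0) := by
        ext x i
        obtain ⟨i, hi⟩ := i
        obtain rfl : i = 0 := by simpa using hi
        rfl
      rw [this, ← Measure.map_map (by fun_prop) (by fun_prop), h0,
        Measure.map_map (by fun_prop) (by fun_prop)]
    | succ n ih =>
      let g : (Finset.Iic n → Z) × Z → (Finset.Iic (n + 1) → Z) := fun p i =>
        if h : (i : ℕ) ≤ n then p.1 ⟨i, Finset.mem_Iic.2 h⟩ else p.2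
      have hg : Measurable g := by
        refine measurable_pi_lambda _ fun i => ?_
        by_cases h : (i : ℕ) ≤ n
        · simp only [g, h, dite_true]; fun_prop
        · simp only [g, h, dite_false]; fun_prop
      have hgx : ∀ x : ℕ → Z, Preorder.frestrictLe (n + 1) x
          = g (Preorder.frestrictLe n x, x (n + 1)) := by
        intro x
        ext ⟨i, hi⟩
        by_cases h : i ≤ n
        · simp [g, h]
        · obtain rfl : i = n + 1 := by
            have := Finset.mem_Iic.1 hi
            omega
          simp [g]
      have hl : ∀ ρ : Measure (ℕ → Z), IsMarkovLaw κ ρ → ∀ F : (Finset.Iic (n + 1) → Z) → ℝ≥0∞,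
          Measurable F → ∫⁻ y, F y ∂(ρ.map (Preorder.frestrictLe (n + 1))) =
            ∫⁻ y, ∫⁻ z, F (g (y, z)) ∂(historyKernel κ n y) ∂(ρ.map (Preorder.frestrictLe n)) := by
        intro ρ hρ F hF
        rw [lintegral_map hF (by fun_prop), lintegral_map _ (by fun_prop)]
        · simp_rw [hgx]
          exact hρ n (fun p => F (g p)) (hF.comp hg)
        · exact Measurable.lintegral_kernel_prod_right' (κ := historyKernel κ n)
            (f := fun p => F (g p)) (hF.comp hg)
      refine Measure.ext_of_lintegral _ fun F hF => ?_
      rw [hl ρ₁ h₁ F hF, hl ρ₂ h₂ F hF, ih]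
  exact measure_ext_frestrictLe key

/-- The law of the Markov chain with transition kernel `κ`, as a kernel in the initial state. -/
noncomputable def chainKernel (κ : Kernel Z Z) [IsMarkovKernel κ] : Kernel Z (ℕ → Z) :=
  (Kernel.traj (X := fun _ => Z) (historyKernel κ) 0).comap
    (MeasurableEquiv.piUnique (fun _ : Finset.Iic 0 => Z)).symm (by fun_prop)

instance (κ : Kernel Z Z) [IsMarkovKernel κ] : IsMarkovKernel (chainKernel κ) := by
  unfold chainKernel; infer_instance

/-- Disintegration over the initial state. It gives access to the functions `z ↦ P_z(A)` and to
comparisons between initial laws. -/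
lemma chainLaw_eq_bind (κ : Kernel Z Z) [IsMarkovKernel κ] (η : Measure Z) :
    chainLaw κ η = η.bind (chainKernel κ) := by
  refine Measure.ext fun s hs => ?_
  change (Measure.bind (η.map _) (Kernel.traj (X := fun _ => Z) (historyKernel κ) 0)) s = _
  rw [Measure.bind_apply hs (Kernel.aemeasurable _), Measure.bind_apply hs (Kernel.aemeasurable _),
    lintegral_map (Kernel.measurable_coe _ hs) (by fun_prop)]
  rfl

instance (κ : Kernel Z Z) [IsMarkovKernel κ] (η : Measure Z) [IsFiniteMeasure η] :
    IsFiniteMeasure (chainLaw κ η) := by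
  rw [chainLaw_eq_bind]; infer_instance

instance (κ : Kernel Z Z) [IsMarkovKernel κ] (η : Measure Z) [IsProbabilityMeasure η] :
    IsProbabilityMeasure (chainLaw κ η) := by
  rw [chainLaw_eq_bind]; infer_instance

lemma chainKernel_map_zero (κ : Kernel Z Z) [IsMarkovKernel κ] (z : Z) :
    (chainKernel κ z).map (fun x => x 0) = Measure.dirac z := by
  have h : (fun x : ℕ → Z => x 0) =
      (fun h : Finset.Iic 0 → Z => h ⟨0, by simp⟩) ∘ (Preorder.frestrictLe 0) := rfl
  rw [h, ← Measure.map_map (by fun_prop) (by fun_prop)]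
  change Measure.map _ (Measure.map _ (Kernel.traj (X := fun _ => Z) (historyKernel κ) 0 _)) = _
  rw [Kernel.traj_map_frestrictLe_apply, Kernel.partialTraj_self, Kernel.id_apply]
  refine Measure.ext fun s hs => ?_
  rw [Measure.map_apply (by fun_prop) hs, Measure.dirac_apply' _ hs]
  exact Measure.dirac_apply' _ ((by fun_prop :
    Measurable (fun h : Finset.Iic 0 → Z => h ⟨0, Finset.mem_Iic.2 le_rfl⟩)) hs)

lemma chainLaw_map_zero (κ : Kernel Z Z) [IsMarkovKernel κ] (η : Measure Z) :
    (chainLaw κ η).map (fun x => x 0) = η := by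
  refine Measure.ext fun s hs => ?_
  have hm : Measurable (fun x : ℕ → Z => x 0) := by fun_prop
  rw [chainLaw_eq_bind, Measure.map_apply hm hs, Measure.bind_apply (hm hs) (Kernel.aemeasurable _)]
  simp_rw [← Measure.map_apply hm hs, chainKernel_map_zero]
  simp_rw [Measure.dirac_apply' _ hs]
  rw [lintegral_indicator_one hs]

lemma isMarkovLaw_chainLaw (κ : Kernel Z Z) [IsMarkovKernel κ] (η : Measure Z)
    [IsFiniteMeasure η] : IsMarkovLaw κ (chainLaw κ η) := by
  intro n F hF
  have h : (chainLaw κ η).map (Preorder.frestrictLe n) ⊗ₘ historyKernel κ n =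
      (chainLaw κ η).map (fun x ↦ (Preorder.frestrictLe n x, x (n + 1))) := by
    have hc : chainLaw κ η = Kernel.traj (X := fun _ => Z) (historyKernel κ) 0 ∘ₘ
      (η.map (MeasurableEquiv.piUnique (fun _ : Finset.Iic 0 => Z)).symm) := rfl
    rw [Measure.compProd_eq_comp_prod, hc, Measure.map_comp _ _ (by fun_prop),
      Kernel.traj_map_frestrictLe, Measure.comp_assoc, Measure.map_comp _ _ (by fun_prop)]
    congr with x₀ : 1
    rw [Kernel.comp_apply, ← Measure.compProd_eq_comp_prod, Kernel.map_apply _ (by fun_prop),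
      Kernel.partialTraj_compProd_eq_map_traj (zero_le)]
  have h2 := congrArg (fun μ => ∫⁻ y, F y ∂μ) h
  rw [Measure.lintegral_compProd hF, lintegral_map _ (by fun_prop),
    lintegral_map hF (by fun_prop)] at h2
  · rw [← h2]; rfl
  · exact Measurable.lintegral_kernel_prod_right' hF

lemma chainLaw_eq_of_isMarkovLaw {κ : Kernel Z Z} [IsMarkovKernel κ] {ρ : Measure (ℕ → Z)}
    [IsFiniteMeasure ρ] (h : IsMarkovLaw κ ρ) : ρ = chainLaw κ (ρ.map (fun x => x 0)) :=
  h.ext (isMarkovLaw_chainLaw κ _) (chainLaw_map_zero κ _).symm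

/-- Conditioning on the past up to time `m` and shifting by `m` preserves the Markov property. -/
lemma IsMarkovLaw.map_shiftBy_restrict {κ : Kernel Z Z} [IsMarkovKernel κ] {ρ : Measure (ℕ → Z)}
    (h : IsMarkovLaw κ ρ) (m : ℕ) {S : Set (Finset.Iic m → Z)} (hS : MeasurableSet S) :
    IsMarkovLaw κ ((ρ.restrict (Preorder.frestrictLe m ⁻¹' S)).map (shiftBy m)) := by
  intro n F hF
  have hpre : MeasurableSet (Preorder.frestrictLe (π := fun _ => Z) m ⁻¹' S) :=
    (by fun_prop : Measurable (Preorder.frestrictLe (π := fun _ => Z) m)) hS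
  let r₁ : (Finset.Iic (m + n) → Z) → (Finset.Iic n → Z) :=
    fun y i => y ⟨m + i, by have := Finset.mem_Iic.1 i.2; simp; omega⟩
  let r₂ : (Finset.Iic (m + n) → Z) → (Finset.Iic m → Z) :=
    fun y i => y ⟨i, by have := Finset.mem_Iic.1 i.2; simp; omega⟩
  have hr₁ : Measurable r₁ := by unfold r₁; fun_prop
  have hr₂ : Measurable r₂ := by unfold r₂; fun_prop
  -- The conditioning event is part of the past at time `m + n`, so its indicator can be absorbed
  -- into the test function of the one-step Markov property at that time.
  have hF' : Measurable (fun p : (Finset.Iic (m + n) → Z) × Z =>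
      (r₂ ⁻¹' S).indicator (fun y => F (r₁ y, p.2)) p.1) := by
    have : (fun p : (Finset.Iic (m + n) → Z) × Z =>
      (r₂ ⁻¹' S).indicator (fun y => F (r₁ y, p.2)) p.1) =
      ((fun p : (Finset.Iic (m + n) → Z) × Z => r₂ p.1) ⁻¹' S).indicator
        (fun p => F (r₁ p.1, p.2)) := by
      ext p; rfl
    rw [this]
    refine Measurable.indicator (by fun_prop) ((hr₂.comp measurable_fst) hS)
  have key := h (m + n) _ hF'
  have hker : Measurable (fun x : ℕ → Z => ∫⁻ z, F (Preorder.frestrictLe n x, z) ∂κ (x n)) := by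
    exact (Measurable.lintegral_kernel_prod_right' (κ := historyKernel κ n) hF).comp
      (by fun_prop : Measurable (Preorder.frestrictLe (π := fun _ => Z) n))
  rw [lintegral_map (by fun_prop) (by fun_prop), lintegral_map hker (by fun_prop),
    ← lintegral_indicator hpre, ← lintegral_indicator hpre]
  refine Eq.trans ?_ (key.trans ?_)
  · refine lintegral_congr fun x => ?_
    simp only [Set.indicator]
    rfl
  · refine lintegral_congr fun x => ?_
    by_cases hx : x ∈ Preorder.frestrictLe (π := fun _ => Z) m ⁻¹' S
    · rw [Set.indicator_of_mem hx]
      refine lintegral_congr fun z => ?_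
      exact Set.indicator_of_mem (s := r₂ ⁻¹' S) hx _
    · rw [Set.indicator_of_notMem hx]
      rw [lintegral_eq_zero_of_ae_eq_zero]
      refine ae_of_all _ fun z => ?_
      exact Set.indicator_of_notMem (s := r₂ ⁻¹' S) hx _

/-- The Markov property of a Markov chain. -/
lemma chainLaw_inter_shiftBy (κ : Kernel Z Z) [IsMarkovKernel κ] (η : Measure Z)
    [IsFiniteMeasure η] (m : ℕ) {S : Set (Finset.Iic m → Z)} (hS : MeasurableSet S)
    {A : Set (ℕ → Z)} (hA : MeasurableSet A) :
    chainLaw κ η (shiftBy m ⁻¹' A ∩ Preorder.frestrictLe m ⁻¹' S) =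
      ∫⁻ x in Preorder.frestrictLe m ⁻¹' S, chainKernel κ (x m) A ∂(chainLaw κ η) := by
  -- Restricted to an event of the past and shifted, the law is still Markov for `κ`; by uniqueness
  -- it is the chain started from its own marginal at time `m`.
  have h := chainLaw_eq_of_isMarkovLaw ((isMarkovLaw_chainLaw κ η).map_shiftBy_restrict m hS)
  have h2 := congrArg (fun μ => μ A) h
  beta_reduce at h2
  rw [Measure.map_apply (by fun_prop) hA,
    Measure.restrict_apply ((measurable_shiftBy m) hA)] at h2
  rw [h2, chainLaw_eq_bind, Measure.bind_apply hA (Kernel.aemeasurable _),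
    Measure.map_map (by fun_prop) (by fun_prop),
    lintegral_map (Kernel.measurable_coe _ hA) (by fun_prop), chainLaw_eq_bind]
  rfl

lemma chainLaw_map_eval_one (κ : Kernel Z Z) [IsMarkovKernel κ] (η : Measure Z)
    [IsFiniteMeasure η] : (chainLaw κ η).map (fun x => x 1) = η.bind κ := by
  refine Measure.ext fun s hs => ?_
  have hm : Measurable (s.indicator (1 : Z → ℝ≥0∞)) := measurable_one.indicator hs
  have h := isMarkovLaw_chainLaw κ η 0 (fun p => s.indicator 1 p.2) (by fun_prop)
  rw [Measure.map_apply (by fun_prop) hs, Measure.bind_apply hs (Kernel.aemeasurable _),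
    ← lintegral_indicator_one ((by fun_prop : Measurable (fun x : ℕ → Z => x 1)) hs)]
  refine h.trans ?_
  simp_rw [lintegral_indicator_one hs]
  nth_rewrite 2 [← chainLaw_map_zero κ η]
  rw [lintegral_map (Kernel.measurable_coe _ hs) (by fun_prop)]

lemma chainLaw_map_shiftBy_one (κ : Kernel Z Z) [IsMarkovKernel κ] (η : Measure Z)
    [IsFiniteMeasure η] : (chainLaw κ η).map (shiftBy 1) = chainLaw κ (η.bind κ) := by
  have h := (isMarkovLaw_chainLaw κ η).map_shiftBy_restrict 1 MeasurableSet.univ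
  rw [Set.preimage_univ, Measure.restrict_univ] at h
  rw [chainLaw_eq_of_isMarkovLaw h, Measure.map_map (by fun_prop) (by fun_prop),
    ← chainLaw_map_eval_one κ η]
  rfl

lemma chainLaw_absolutelyContinuous (κ : Kernel Z Z) [IsMarkovKernel κ] {η η' : Measure Z}
    (h : η ≪ η') : chainLaw κ η ≪ chainLaw κ η' := by
  refine Measure.AbsolutelyContinuous.mk fun s hs h0 => ?_
  rw [chainLaw_eq_bind, Measure.bind_apply hs (Kernel.aemeasurable _),
    lintegral_eq_zero_iff (Kernel.measurable_coe _ hs)] at *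
  exact h.ae_le h0

end MarkovChain

/-! ### Ergodicity of a stationary chain with positive transitions. -/

section Ergodicity

variable {Z : Type*} [MeasurableSpace Z]

lemma chainKernel_eq_chainLaw_dirac (κ : Kernel Z Z) [IsMarkovKernel κ] (z : Z) :
    chainKernel κ z = chainLaw κ (Measure.dirac z) := by
  rw [chainLaw_eq_bind, Measure.dirac_bind (Kernel.measurable _)]

lemma shiftBy_preimage_eq {Z : Type*} {A : Set (ℕ → Z)} (h : shiftBy 1 ⁻¹' A = A) (m : ℕ) :
    shiftBy m ⁻¹' A = A := by
  induction m with
  | zero =>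
    have : (shiftBy 0 : (ℕ → Z) → ℕ → Z) = id := by ext x k; simp [shiftBy]
    rw [this, Set.preimage_id]
  | succ m ih =>
    have : (shiftBy (m + 1) : (ℕ → Z) → ℕ → Z) = shiftBy m ∘ shiftBy 1 := by
      ext x k; simp only [shiftBy, Function.comp]; congr 1; omega
    rw [this, Set.preimage_comp, ih, h]

/-- A bounded harmonic function of a positive Markov kernel with a stationary law is constant. -/
lemma harmonic_const {κ : Kernel Z Z} [IsMarkovKernel κ] {π : Measure Z} [IsProbabilityMeasure π]
    (hπ : κ.Invariant π) {m : Measure Z} (h₁ : ∀ z, κ z ≪ m) (h₂ : ∀ z, m ≪ κ z)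
    {h : Z → ℝ≥0∞} (hm : Measurable h) (hb : ∀ z, h z ≤ 1) (hh : ∀ z, ∫⁻ z', h z' ∂κ z = h z) :
    ∃ c, ∀ z, h z = c := by
  have hfin : ∀ z, h z ≠ ∞ := fun z => ((hb z).trans_lt ENNReal.one_lt_top).ne
  let g : Z → ℝ := fun z => (h z).toReal
  have hg : Measurable g := hm.ennreal_toReal
  have hg1 : ∀ z, ‖g z‖ ≤ 1 := fun z => by
    simpa [g] using ENNReal.toReal_mono ENNReal.one_ne_top (hb z)
  have hgL : ∀ z, MemLp g 2 (κ z) := fun z =>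
    MemLp.of_bound hg.aestronglyMeasurable 1 (ae_of_all _ hg1)
  have hgi : ∀ z, ∫ z', g z' ∂κ z = g z := fun z => by
    rw [integral_toReal hm.aemeasurable (ae_of_all _ fun z => (hfin z).lt_top), hh]
  have hsq : ∀ z, ∫ z', (g ^ 2) z' ∂κ z = (∫⁻ z', h z' ^ 2 ∂κ z).toReal := fun z => by
    rw [← integral_toReal (hm.pow_const 2).aemeasurable
      (ae_of_all _ fun z => (ENNReal.pow_ne_top (hfin z)).lt_top)]
    simp [g, ENNReal.toReal_pow]
  have hwfin : ∀ z, ∫⁻ z', h z' ^ 2 ∂κ z ≠ ∞ := fun z => by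
    refine ne_top_of_le_ne_top ENNReal.one_ne_top ?_
    calc ∫⁻ z', h z' ^ 2 ∂κ z ≤ ∫⁻ _, 1 ∂κ z := lintegral_mono fun z => pow_le_one' (hb z) 2
      _ = 1 := by simp
  have hvar : ∀ z, variance g (κ z) = (∫⁻ z', h z' ^ 2 ∂κ z).toReal - (h z ^ 2).toReal := fun z => by
    rw [variance_eq_sub (hgL z), hgi, hsq, ENNReal.toReal_pow]
  -- Jensen for the square: the gap is the variance of `h` under `κ z`. Since both sides have the
  -- same `π`-integral by stationarity, the gap vanishes `π`-almost everywhere.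
  have hle : ∀ z, h z ^ 2 ≤ ∫⁻ z', h z' ^ 2 ∂κ z := fun z => by
    have := variance_nonneg g (κ z)
    rw [hvar] at this
    exact (ENNReal.toReal_le_toReal (ENNReal.pow_ne_top (hfin z)) (hwfin z)).1 (by linarith)
  have hmw : Measurable fun z => ∫⁻ z', h z' ^ 2 ∂κ z := (hm.pow_const 2).lintegral_kernel
  have hint : ∫⁻ z, ∫⁻ z', h z' ^ 2 ∂κ z ∂π = ∫⁻ z, h z ^ 2 ∂π := by
    rw [← Measure.lintegral_bind (Kernel.aemeasurable _) (hm.pow_const 2).aemeasurable, hπ]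
  have hae : (fun z => h z ^ 2) =ᵐ[π] fun z => ∫⁻ z', h z' ^ 2 ∂κ z := by
    refine ae_eq_of_ae_le_of_lintegral_le (ae_of_all _ hle) ?_ hmw.aemeasurable hint.le
    refine ne_top_of_le_ne_top ENNReal.one_ne_top ?_
    calc ∫⁻ z, h z ^ 2 ∂π ≤ ∫⁻ _, 1 ∂π := lintegral_mono fun z => pow_le_one' (hb z) 2
      _ = 1 := by simp
  -- One point of zero variance suffices: `h` is then constant almost everywhere for `κ z₀`, hence
  -- for `m`, hence for every `κ z`, and harmonicity makes it constant everywhere.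
  obtain ⟨z₀, hz₀⟩ := hae.exists
  have hv0 : evariance g (κ z₀) = 0 := by
    rw [← (hgL z₀).ofReal_variance_eq, hvar]
    beta_reduce at hz₀
    rw [← hz₀]
    simp
  have hconst : g =ᵐ[κ z₀] fun _ => g z₀ := by
    have := (evariance_eq_zero_iff hg.aemeasurable).1 hv0
    rwa [hgi] at this
  have hconst' : h =ᵐ[m] fun _ => h z₀ := by
    refine (h₂ z₀).ae_le ?_
    filter_upwards [hconst] with z hz
    exact (ENNReal.toReal_eq_toReal_iff' (hfin _) (hfin _)).1 hz
  refine ⟨h z₀, fun z => ?_⟩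
  rw [← hh z, lintegral_congr_ae ((h₁ z).ae_le hconst')]
  simp

/-- The shift is ergodic for a stationary Markov chain with a positive transition kernel. -/
theorem ergodic_shiftBy_chainLaw {κ : Kernel Z Z} [IsMarkovKernel κ] {π : Measure Z}
    [IsProbabilityMeasure π] (hπ : κ.Invariant π) {m : Measure Z}
    (h₁ : ∀ z, κ z ≪ m) (h₂ : ∀ z, m ≪ κ z) :
    Ergodic (shiftBy 1) (chainLaw κ π) := by
  have hmap : (chainLaw κ π).map (shiftBy 1) = chainLaw κ π := by
    rw [chainLaw_map_shiftBy_one, hπ]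
  refine ⟨⟨measurable_shiftBy 1, hmap⟩, ⟨fun A hA hinv => ?_⟩⟩
  -- For a shift-invariant `A`, the function `z ↦ P_z(A)` is harmonic.
  obtain ⟨c, hc⟩ := harmonic_const hπ h₁ h₂ (Kernel.measurable_coe (chainKernel κ) hA)
    (fun z => prob_le_one) (fun z => by
      rw [chainKernel_eq_chainLaw_dirac]
      nth_rewrite 2 [← hinv]
      rw [← Measure.map_apply (measurable_shiftBy 1) hA, chainLaw_map_shiftBy_one,
        Measure.dirac_bind (Kernel.measurable _), chainLaw_eq_bind,
        Measure.bind_apply hA (Kernel.aemeasurable _)])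
  -- Since `A` is its own shift by `n`, its conditional probability given the past at time `n` is
  -- `c`. So `A` is independent of every finite past, hence of itself.
  have hres : (chainLaw κ π).restrict A = c • chainLaw κ π := by
    have hcfin : c ≠ ∞ := by
      obtain ⟨z⟩ : Nonempty Z := nonempty_of_isProbabilityMeasure π
      rw [← hc z]; exact measure_ne_top _ _
    have : IsFiniteMeasure (c • chainLaw κ π) := Measure.smul_finite _ hcfin
    refine measure_ext_frestrictLe fun n => Measure.ext fun S hS => ?_
    have hS' : MeasurableSet (Preorder.frestrictLe (π := fun _ => Z) n ⁻¹' S) :=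
      (by fun_prop : Measurable (Preorder.frestrictLe (π := fun _ => Z) n)) hS
    rw [Measure.map_apply (by fun_prop) hS, Measure.map_apply (by fun_prop) hS,
      Measure.restrict_apply hS', Measure.smul_apply, smul_eq_mul]
    have := chainLaw_inter_shiftBy κ π n hS hA
    rw [shiftBy_preimage_eq hinv, Set.inter_comm] at this
    rw [this]
    simp [hc]
  have h0 : c * chainLaw κ π Aᶜ = 0 := by
    have := congrArg (fun μ => μ Aᶜ) hres
    simpa [Measure.restrict_apply hA.compl] using this.symm
  rw [eventuallyConst_set]
  rcases mul_eq_zero.1 h0 with h | h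
  · right
    have := congrArg (fun μ => μ Set.univ) hres
    simp only [h, Measure.restrict_apply_univ, zero_smul, Measure.coe_zero, Pi.zero_apply] at this
    exact measure_eq_zero_iff_ae_notMem.1 this
  · left
    exact mem_ae_iff.2 h

end Ergodicity

/-! ### A one-sided ergodic theorem. -/

section Birkhoff

variable {Ω : Type*} [MeasurableSpace Ω]

/-- If `f` has a positive mean, then its Birkhoff sums along an ergodic map are almost surely
bounded below. -/
theorem ae_bddBelow_birkhoffSum {T : Ω → Ω} {P : Measure Ω} [IsProbabilityMeasure P]
    (hT : Ergodic T P) {f : Ω → ℝ} (hfm : Measurable f) (hf : Integrable f P)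
    (hpos : 0 < ∫ ω, f ω ∂P) :
    ∀ᵐ ω ∂P, ∃ k : ℕ, ∀ n, -(k : ℝ) ≤ birkhoffSum T f n ω := by
  have hTm : Measurable T := hT.measurable
  have hSm : ∀ n, Measurable (birkhoffSum T f n) := fun n => by
    unfold birkhoffSum
    exact Finset.measurable_sum _ fun i _ => hfm.comp (hTm.iterate i)
  let G : Set Ω := {ω | ∃ k : ℕ, ∀ n, -(k : ℝ) ≤ birkhoffSum T f n ω}
  have hG : MeasurableSet G := by
    have : G = ⋃ k : ℕ, ⋂ n, {ω | -(k : ℝ) ≤ birkhoffSum T f n ω} := by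
      ext ω; simp [G]
    rw [this]
    exact MeasurableSet.iUnion fun k => MeasurableSet.iInter fun n =>
      measurableSet_le measurable_const (hSm n)
  have hinv : T ⁻¹' G = G := by
    ext ω
    constructor
    · rintro ⟨k, hk⟩
      obtain ⟨l, hl⟩ := exists_nat_ge (|f ω| + k)
      refine ⟨l, fun n => ?_⟩
      cases n with
      | zero => simp
      | succ n =>
        rw [birkhoffSum_succ']
        have := hk n
        have := neg_abs_le (f ω)
        linarith
    · rintro ⟨k, hk⟩
      obtain ⟨l, hl⟩ := exists_nat_ge (|f ω| + k)
      refine ⟨l, fun n => ?_⟩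
      have := hk (n + 1)
      rw [birkhoffSum_succ'] at this
      have := le_abs_self (f ω)
      linarith
  rcases hT.toPreErgodic.ae_mem_or_ae_notMem hG hinv with h | h
  · exact h
  exfalso
  -- `M n` is the minimum of the Birkhoff sums of orders `0, …, n`, with the order `0` sum equal to
  -- `0`; the recursion splits off the first term of the orbit.
  let M : ℕ → Ω → ℝ := fun n => Nat.rec (fun _ => 0) (fun _ u ω => min 0 (f ω + u (T ω))) n
  have hM0 : ∀ ω, M 0 ω = 0 := fun ω => rfl
  have hMs : ∀ n ω, M (n + 1) ω = min 0 (f ω + M n (T ω)) := fun n ω => rfl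
  have hMm : ∀ n, Measurable (M n) := fun n => by
    induction n with
    | zero => exact measurable_const
    | succ n ih => exact measurable_const.min (hfm.add (ih.comp hTm))
  have hMi : ∀ n, Integrable (M n) P := fun n => by
    induction n with
    | zero => exact integrable_const _
    | succ n ih =>
      exact (integrable_const 0).inf (hf.add (hT.toMeasurePreserving.integrable_comp_of_integrable ih))
  have hMneg : ∀ n ω, M n ω ≤ 0 := fun n ω => by
    cases n with
    | zero => exact le_rfl
    | succ n => exact min_le_left _ _
  have hManti : ∀ n ω, M (n + 1) ω ≤ M n ω := fun n => by
    induction n with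
    | zero => exact fun ω => min_le_left _ _
    | succ n ih =>
      intro ω
      rw [hMs (n + 1), hMs n]
      exact min_le_min_left _ (by linarith [ih (T ω)])
  have hMS : ∀ n ω, M n ω ≤ birkhoffSum T f n ω := fun n => by
    induction n with
    | zero => intro ω; simp [hM0]
    | succ n ih =>
      intro ω
      rw [hMs, birkhoffSum_succ']
      exact (min_le_right _ _).trans (by linarith [ih (T ω)])
  have hφ : ∀ n ω, M (n + 1) ω - M n (T ω) = min (-M n (T ω)) (f ω) := fun n ω => by
    rw [hMs, ← min_sub_sub_right]; congr 1 <;> ring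
  -- By invariance the integral is `∫ M (n + 1) - ∫ M n`, and `M` decreases in `n`.
  have hle : ∀ n, ∫ ω, min (-M n (T ω)) (f ω) ∂P ≤ 0 := fun n => by
    have e1 : ∫ ω, M n (T ω) ∂P = ∫ ω, M n ω ∂P := by
      conv_rhs => rw [← hT.toMeasurePreserving.map_eq]
      rw [integral_map hTm.aemeasurable (hMm n).aestronglyMeasurable]
    simp_rw [← hφ]
    have e2 : Integrable (fun ω => M n (T ω)) P :=
      hT.toMeasurePreserving.integrable_comp_of_integrable (hMi n)
    rw [integral_sub (hMi (n + 1)) e2, e1]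
    linarith [integral_mono (hMi (n + 1)) (hMi n) (hManti n)]
  -- If the sums are almost surely unbounded below, then `-M n ∘ T` tends to `∞` and the truncation
  -- of `f` disappears in the limit. Domination by `|f|` holds because `-M n` is nonnegative.
  have hlim : Tendsto (fun n => ∫ ω, min (-M n (T ω)) (f ω) ∂P) atTop (𝓝 (∫ ω, f ω ∂P)) := by
    refine tendsto_integral_of_dominated_convergence (fun ω => |f ω|)
      (fun n => (((hMm n).comp hTm).neg.min hfm).aestronglyMeasurable) hf.abs
      (fun n => ae_of_all _ fun ω => ?_) ?_
    · rw [Real.norm_eq_abs, abs_le]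
      have := hMneg n (T ω)
      exact ⟨le_min ((neg_nonpos.2 (abs_nonneg _)).trans (by linarith)) (neg_abs_le _),
        (min_le_right _ _).trans (le_abs_self _)⟩
    · filter_upwards [h] with ω hω
      have hTω : T ω ∉ G := fun hc => hω (by rw [← hinv]; exact hc)
      obtain ⟨k, hk⟩ := exists_nat_ge (f ω)
      have : ∃ n, M n (T ω) ≤ -(k : ℝ) := by
        refine not_forall_not.1 fun hcon => hTω ⟨k, fun n => ?_⟩
        exact (not_le.1 (hcon n)).le.trans (hMS n _)
      obtain ⟨n₀, hn₀⟩ := this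
      refine tendsto_const_nhds.congr' ?_
      filter_upwards [eventually_ge_atTop n₀] with n hn
      have : M n (T ω) ≤ M n₀ (T ω) := antitone_nat_of_succ_le (f := fun n => M n (T ω))
        (fun n => hManti n _) hn
      rw [min_eq_right]
      linarith
  exact absurd (le_of_tendsto' hlim hle) (not_le.2 hpos)

end Birkhoff

/-! ### Joint densities of the states of a dominated chain. -/

section Density

/-- The product of the transition densities along a path. -/
noncomputable def pathProd {Z : Type*} (q : Z → Z → ℝ≥0∞) {n : ℕ} (z : Fin (n + 1) → Z) : ℝ≥0∞ :=
  ∏ i : Fin n, q (z i.castSucc) (z i.succ)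

lemma pathProd_snoc {Z : Type*} (q : Z → Z → ℝ≥0∞) {n : ℕ} (z : Fin (n + 1) → Z) (z' : Z) :
    pathProd q (Fin.snoc z z' : Fin (n + 2) → Z) = pathProd q z * q (z (Fin.last n)) z' := by
  unfold pathProd
  rw [Fin.prod_univ_castSucc]
  congr 1
  · refine Finset.prod_congr rfl fun i _ => ?_
    rw [Fin.snoc_castSucc, Fin.succ_castSucc, Fin.snoc_castSucc]
  · rw [Fin.snoc_castSucc, Fin.succ_last, Fin.snoc_last]

variable {Z : Type*} [MeasurableSpace Z]

lemma measurable_pathProd {q : Z → Z → ℝ≥0∞} (hq : Measurable (Function.uncurry q)) {n : ℕ} :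
    Measurable (pathProd q : (Fin (n + 1) → Z) → ℝ≥0∞) := by
  unfold pathProd
  exact Finset.measurable_prod _ fun i _ =>
    hq.comp (by fun_prop : Measurable fun z : Fin (n + 1) → Z => (z i.castSucc, z i.succ))

@[fun_prop]
lemma measurable_finCons {n : ℕ} :
    Measurable (fun p : Z × (Fin n → Z) => (Fin.cons p.1 p.2 : Fin (n + 1) → Z)) := by
  refine measurable_pi_lambda _ fun i => ?_
  refine Fin.cases ?_ (fun j => ?_) i
  · simpa using measurable_fst
  · simp only [Fin.cons_succ]; fun_prop

@[fun_prop]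
lemma measurable_finSnoc {n : ℕ} :
    Measurable (fun p : (Fin n → Z) × Z => (Fin.snoc p.1 p.2 : Fin (n + 1) → Z)) := by
  refine measurable_pi_lambda _ fun i => ?_
  refine Fin.lastCases ?_ (fun j => ?_) i
  · simpa using measurable_snd
  · simp only [Fin.snoc_castSucc]; fun_prop

lemma lintegral_pi_snoc (m : Measure Z) [SigmaFinite m] {n : ℕ}
    {F : (Fin (n + 1) → Z) → ℝ≥0∞} (hF : Measurable F) :
    ∫⁻ z, F z ∂Measure.pi (fun _ => m) =
      ∫⁻ z, ∫⁻ z', F (Fin.snoc z z') ∂m ∂Measure.pi (fun _ : Fin n => m) := by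
  have h := (measurePreserving_piFinSuccAbove (fun _ : Fin (n + 1) => m) (Fin.last n)).symm
  rw [← h.lintegral_comp hF, lintegral_prod_symm']
  · simp [MeasurableEquiv.piFinSuccAbove_symm_apply, Fin.insertNthEquiv, Fin.insertNth_last']
  · exact hF.comp (MeasurableEquiv.measurable _)

/-- The law of the first states of a Markov chain whose transition kernel has a density. -/
lemma lintegral_chainLaw_initial {κ : Kernel Z Z} [IsMarkovKernel κ] {m : Measure Z} [SigmaFinite m]
    {q : Z → Z → ℝ≥0∞} (hq : Measurable (Function.uncurry q))
    (hκ : ∀ z, κ z = m.withDensity (q z)) (η : Measure Z) [IsFiniteMeasure η] {n : ℕ}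
    {F : (Fin (n + 1) → Z) → ℝ≥0∞} (hF : Measurable F) :
    ∫⁻ ω, F (fun i => ω i) ∂chainLaw κ η =
      ∫⁻ z₀, ∫⁻ z, F (Fin.cons z₀ z) * pathProd q (Fin.cons z₀ z : Fin (n + 1) → Z)
        ∂Measure.pi (fun _ : Fin n => m) ∂η := by
  induction n with
  | zero =>
    have h1 : ∀ z₀ : Z, ∀ z : Fin 0 → Z, (Fin.cons z₀ z : Fin 1 → Z) = fun _ => z₀ := by
      intro z₀ z
      ext i
      obtain rfl : i = 0 := Fin.fin_one_eq_zero i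
      rfl
    simp only [h1, pathProd, Finset.univ_eq_empty, Finset.prod_empty, mul_one]
    have h2 : ∀ ω : ℕ → Z, (fun i : Fin (0 + 1) => ω i) = fun _ => ω 0 := by
      intro ω
      ext i
      obtain rfl : i = 0 := Fin.fin_one_eq_zero i
      rfl
    simp only [h2]
    have h3 : Measurable fun z₀ : Z => F fun _ => z₀ := hF.comp (by fun_prop)
    conv_rhs => rw [← chainLaw_map_zero κ η]
    rw [lintegral_map (by fun_prop) (by fun_prop)]
    simp
  | succ n ih =>
    -- The last state is integrated out with the transition density, so the induction hypothesis
    -- applies to a function of one state fewer.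
    let G : (Fin (n + 1) → Z) → ℝ≥0∞ := fun w => ∫⁻ z', F (Fin.snoc w z') * q (w (Fin.last n)) z' ∂m
    have hFs : Measurable fun p : (Fin (n + 1) → Z) × Z => F (Fin.snoc p.1 p.2) :=
      hF.comp measurable_finSnoc
    have hqs : Measurable fun p : (Fin (n + 1) → Z) × Z => q (p.1 (Fin.last n)) p.2 :=
      hq.comp (by fun_prop : Measurable fun p : (Fin (n + 1) → Z) × Z => (p.1 (Fin.last n), p.2))
    have hG : Measurable G := Measurable.lintegral_prod_right' (hFs.mul hqs)
    let r : (Finset.Iic n → Z) → (Fin (n + 1) → Z) :=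
      fun h i => h ⟨i, Finset.mem_Iic.2 (Nat.lt_succ_iff.1 i.2)⟩
    have hr : Measurable r := by unfold r; fun_prop
    have hM := isMarkovLaw_chainLaw κ η n (fun p => F (Fin.snoc (r p.1) p.2))
      (hFs.comp ((hr.comp measurable_fst).prodMk measurable_snd))
    have e1 : ∀ ω : ℕ → Z, F (Fin.snoc (r (Preorder.frestrictLe n ω)) (ω (n + 1))) =
        F (fun i => ω i) := fun ω => by
      congr 1
      ext i
      refine Fin.lastCases ?_ (fun j => ?_) i
      · simp
      · simp [r]
    have e2 : ∀ ω : ℕ → Z, ∫⁻ z', F (Fin.snoc (r (Preorder.frestrictLe n ω)) z') ∂κ (ω n) =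
        G (fun i => ω i) := fun ω => by
      have hq' : Measurable (q (ω n)) := hq.comp measurable_prodMk_left
      have hF' : Measurable fun z' => F (Fin.snoc (r (Preorder.frestrictLe n ω)) z') :=
        hFs.comp measurable_prodMk_left
      rw [hκ, lintegral_withDensity_eq_lintegral_mul _ hq' hF']
      refine lintegral_congr fun z' => ?_
      rw [Pi.mul_apply, mul_comm]
      rfl
    simp only [e1, e2] at hM
    rw [hM, ih hG]
    refine lintegral_congr fun z₀ => ?_
    have hc : Measurable fun z : Fin (n + 1) → Z => (Fin.cons z₀ z : Fin (n + 2) → Z) :=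
      measurable_finCons.comp measurable_prodMk_left
    rw [lintegral_pi_snoc m (F := fun z => F (Fin.cons z₀ z) * pathProd q (Fin.cons z₀ z))
      ((hF.comp hc).mul ((measurable_pathProd hq).comp hc))]
    refine lintegral_congr fun z => ?_
    rw [← lintegral_mul_const]
    · refine lintegral_congr fun z' => ?_
      simp only [Fin.cons_snoc_eq_snoc_cons, pathProd_snoc]
      ring
    · exact (hFs.mul hqs).comp (by fun_prop : Measurable fun z' : Z => ((Fin.cons z₀ z : Fin (n + 1) → Z), z'))

end Density

/-! ### Densities of the states and of the observations. -/

namespace FullyDominated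

variable {Θ : Type u} {X : Type v} {Y : Type w}
  [MeasurableSpace Θ] [MeasurableSpace X] [MeasurableSpace Y]

/-- The density of `(Z_1, …, Z_n)` for the chain started from `η`. -/
noncomputable def stateDensity (M : FullyDominated Θ X Y) (η : Measure (X × Y)) (θ : Θ) {n : ℕ}
    (z : Fin n → X × Y) : ℝ≥0∞ :=
  ∫⁻ z₀, pathProd (M.q θ) (Fin.cons z₀ z : Fin (n + 1) → X × Y) ∂η

/-- Joining hidden and observed coordinates. -/
def joinObs {n : ℕ} (y : Fin n → Y) (x : Fin n → X) : Fin n → X × Y := fun i => (x i, y i)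

@[fun_prop]
lemma measurable_joinObs {n : ℕ} :
    Measurable (fun p : (Fin n → Y) × (Fin n → X) => joinObs p.1 p.2) := by
  unfold joinObs; fun_prop

@[fun_prop]
lemma measurable_joinObs_right {n : ℕ} (y : Fin n → Y) :
    Measurable (fun x : Fin n → X => joinObs y x) := by
  unfold joinObs; fun_prop

/-- The states at times `1, …, n`. -/
def states (n : ℕ) (ω : ℕ → X × Y) : Fin n → X × Y := fun i => ω (i + 1)

@[fun_prop]
lemma measurable_states (n : ℕ) : Measurable (states n : (ℕ → X × Y) → _) := by
  unfold states; fun_prop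

@[fun_prop]
lemma measurable_obs (n : ℕ) : Measurable (obs n : (ℕ → X × Y) → _) := by
  unfold obs; fun_prop

variable (M : FullyDominated Θ X Y)

lemma measurable_pathProd_joint {n : ℕ} :
    Measurable fun p : Θ × (Fin (n + 1) → X × Y) => pathProd (M.q p.1) p.2 := by
  unfold pathProd
  exact Finset.measurable_prod _ fun i _ => M.measurable_q.comp (by fun_prop :
    Measurable fun p : Θ × (Fin (n + 1) → X × Y) => (p.1, p.2 i.castSucc, p.2 i.succ))

lemma measurable_uncurry_q (θ : Θ) : Measurable (Function.uncurry (M.q θ)) :=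
  M.measurable_q.comp (by fun_prop : Measurable fun p : (X × Y) × (X × Y) => (θ, p.1, p.2))

lemma measurable_stateDensity_joint (η : Measure (X × Y)) [SFinite η] {n : ℕ} :
    Measurable fun p : Θ × (Fin n → X × Y) => M.stateDensity η p.1 p.2 := by
  unfold stateDensity
  refine Measurable.lintegral_prod_right' (f := fun r : (Θ × (Fin n → X × Y)) × (X × Y) =>
    pathProd (M.q r.1.1) (Fin.cons r.2 r.1.2 : Fin (n + 1) → X × Y)) ?_
  exact M.measurable_pathProd_joint.comp ((measurable_fst.comp measurable_fst).prodMk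
    (measurable_finCons.comp (by fun_prop : Measurable
      fun r : (Θ × (Fin n → X × Y)) × (X × Y) => (r.2, r.1.2))))

@[fun_prop]
lemma measurable_stateDensity (η : Measure (X × Y)) [SFinite η] (θ : Θ) {n : ℕ} :
    Measurable (M.stateDensity η θ : (Fin n → X × Y) → ℝ≥0∞) :=
  (M.measurable_stateDensity_joint η).comp measurable_prodMk_left

/-- Tonelli: the likelihood is the state density with the hidden coordinates integrated out. This is
the link between complete and partial observations. -/
lemma likelihood_eq_lintegral (η : Measure (X × Y)) [SFinite η] (θ : Θ) {n : ℕ} (y : Fin n → Y) :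
    M.likelihood η θ y = ∫⁻ x, M.stateDensity η θ (joinObs y x) ∂Measure.pi fun _ => M.μ := by
  unfold stateDensity
  rw [lintegral_lintegral_swap]
  · rfl
  · refine Measurable.aemeasurable ?_
    exact (measurable_pathProd (M.measurable_uncurry_q θ)).comp (measurable_finCons.comp
      (by fun_prop : Measurable fun r : (Fin n → X) × (X × Y) => (r.2, joinObs y r.1)))

lemma measurable_likelihood_joint (η : Measure (X × Y)) [SFinite η] {n : ℕ} :
    Measurable fun p : Θ × (Fin n → Y) => M.likelihood η p.1 p.2 := by
  simp_rw [likelihood_eq_lintegral]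
  refine Measurable.lintegral_prod_right' (f := fun r : (Θ × (Fin n → Y)) × (Fin n → X) =>
    M.stateDensity η r.1.1 (joinObs r.1.2 r.2)) ?_
  exact (M.measurable_stateDensity_joint η).comp (by fun_prop : Measurable
    fun r : (Θ × (Fin n → Y)) × (Fin n → X) => (r.1.1, joinObs r.1.2 r.2))

@[fun_prop]
lemma measurable_likelihood (η : Measure (X × Y)) [SFinite η] (θ : Θ) {n : ℕ} :
    Measurable (M.likelihood η θ : (Fin n → Y) → ℝ≥0∞) :=
  (M.measurable_likelihood_joint η).comp measurable_prodMk_left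

lemma lintegral_pi_joinObs {n : ℕ} {F : (Fin n → X × Y) → ℝ≥0∞} (hF : Measurable F) :
    ∫⁻ z, F z ∂Measure.pi (fun _ => M.μ.prod M.ν) =
      ∫⁻ y, ∫⁻ x, F (joinObs y x) ∂Measure.pi (fun _ => M.μ) ∂Measure.pi (fun _ => M.ν) := by
  have h := (measurePreserving_arrowProdEquivProdArrow X Y (Fin n) (fun _ => M.μ)
    (fun _ => M.ν)).symm
  rw [← h.lintegral_comp hF, lintegral_prod_symm']
  · rfl
  · exact hF.comp (MeasurableEquiv.measurable _)

/-- The law of `(Z_1, …, Z_n)` has density `stateDensity`. -/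
lemma lintegral_states (θ : Θ) (η : Measure (X × Y)) [IsFiniteMeasure η] {n : ℕ}
    {F : (Fin n → X × Y) → ℝ≥0∞} (hF : Measurable F) :
    ∫⁻ ω, F (states n ω) ∂M.law θ η =
      ∫⁻ z, F z * M.stateDensity η θ z ∂Measure.pi fun _ => M.μ.prod M.ν := by
  have hF' : Measurable fun z : Fin (n + 1) → X × Y => F (fun i => z i.succ) :=
    hF.comp (by fun_prop)
  have hc : Measurable fun p : (X × Y) × (Fin n → X × Y) =>
      pathProd (M.q θ) (Fin.cons p.1 p.2 : Fin (n + 1) → X × Y) :=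
    (measurable_pathProd (M.measurable_uncurry_q θ)).comp measurable_finCons
  have h := lintegral_chainLaw_initial (M.measurable_uncurry_q θ) (M.Q_eq_withDensity θ) η hF'
  simp only [Fin.cons_succ, Fin.val_succ] at h
  refine h.trans ?_
  rw [lintegral_lintegral_swap]
  · refine lintegral_congr fun z => ?_
    exact lintegral_const_mul _ (hc.comp (by fun_prop : Measurable fun z₀ : X × Y => (z₀, z)))
  · exact ((hF.comp measurable_snd).mul hc).aemeasurable

/-- The law of `(Y_1, …, Y_n)` has density `likelihood`. -/
lemma lintegral_obs (θ : Θ) (η : Measure (X × Y)) [IsFiniteMeasure η] {n : ℕ}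
    {F : (Fin n → Y) → ℝ≥0∞} (hF : Measurable F) :
    ∫⁻ ω, F (obs n ω) ∂M.law θ η =
      ∫⁻ y, F y * M.likelihood η θ y ∂Measure.pi fun _ => M.ν := by
  have hF' : Measurable fun z : Fin n → X × Y => F (fun i => (z i).2) := hF.comp (by fun_prop)
  refine (M.lintegral_states θ η hF').trans ?_
  rw [M.lintegral_pi_joinObs (by fun_prop)]
  refine lintegral_congr fun y => ?_
  rw [likelihood_eq_lintegral, ← lintegral_const_mul _ (by fun_prop)]
  rfl

end FullyDominated

lemma shiftBy_one_iterate {Z : Type*} (n : ℕ) (x : ℕ → Z) : (shiftBy 1)^[n] x = shiftBy n x := by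
  induction n generalizing x with
  | zero => ext k; simp [shiftBy]
  | succ n ih =>
    rw [Function.iterate_succ_apply, ih]
    ext k
    simp only [shiftBy]
    congr 1
    omega

lemma chainLaw_map_pair {Z : Type*} [MeasurableSpace Z] (κ : Kernel Z Z) [IsMarkovKernel κ]
    (π : Measure Z) [IsFiniteMeasure π] :
    (chainLaw κ π).map (fun ω => (ω 0, ω 1)) = π ⊗ₘ κ := by
  refine Measure.ext_of_lintegral _ fun F hF => ?_
  have h := isMarkovLaw_chainLaw κ π 0 (fun p => F (p.1 ⟨0, Finset.mem_Iic.2 le_rfl⟩, p.2))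
    (by fun_prop)
  rw [lintegral_map hF (by fun_prop), Measure.lintegral_compProd hF]
  refine h.trans ?_
  have hm : Measurable fun z => ∫⁻ z', F (z, z') ∂κ z := hF.lintegral_kernel_prod_right'
  conv_rhs => rw [← chainLaw_map_zero κ π]
  rw [lintegral_map hm (by fun_prop)]
  rfl

/-! ### Log-likelihood ratios and Kullback-Leibler divergence. -/

namespace FullyDominated

variable {Θ : Type u} {X : Type v} {Y : Type w}
  [MeasurableSpace Θ] [MeasurableSpace X] [MeasurableSpace Y] (M : FullyDominated Θ X Y)

@[fun_prop]
lemma measurable_q_right (θ : Θ) (z : X × Y) : Measurable (M.q θ z) :=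
  (M.measurable_uncurry_q θ).comp measurable_prodMk_left

lemma Q_absolutelyContinuous (θ : Θ) (z : X × Y) : M.Q θ z ≪ M.μ.prod M.ν := by
  rw [M.Q_eq_withDensity]; exact withDensity_absolutelyContinuous _ _

lemma absolutelyContinuous_Q {θ : Θ} {z : X × Y}
    (h : ∀ᵐ z' ∂(M.μ.prod M.ν), 0 < M.q θ z z') : M.μ.prod M.ν ≪ M.Q θ z := by
  rw [M.Q_eq_withDensity]
  exact withDensity_absolutelyContinuous' (M.measurable_q_right θ z).aemeasurable
    (h.mono fun _ h => h.ne')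

lemma lintegral_q (θ : Θ) (z : X × Y) : ∫⁻ z', M.q θ z z' ∂(M.μ.prod M.ν) = 1 := by
  have h : M.Q θ z Set.univ = 1 := measure_univ
  rwa [M.Q_eq_withDensity, withDensity_apply _ MeasurableSet.univ, Measure.restrict_univ] at h

lemma ae_q_lt_top (θ : Θ) (z : X × Y) : ∀ᵐ z' ∂(M.μ.prod M.ν), M.q θ z z' < ∞ :=
  ae_lt_top (M.measurable_q_right θ z) (by rw [lintegral_q]; exact ENNReal.one_ne_top)

lemma measurable_div_q (θ₀ θ : Θ) :
    Measurable fun p : (X × Y) × (X × Y) => M.q θ₀ p.1 p.2 / M.q θ p.1 p.2 :=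
  (M.measurable_uncurry_q θ₀).div (M.measurable_uncurry_q θ)

/-- The log-likelihood ratio of the transition densities. -/
noncomputable def logRatio (θ₀ θ : Θ) (p : (X × Y) × (X × Y)) : ℝ :=
  Real.log (M.q θ₀ p.1 p.2 / M.q θ p.1 p.2).toReal

@[fun_prop]
lemma measurable_logRatio (θ₀ θ : Θ) : Measurable (M.logRatio θ₀ θ) :=
  Real.measurable_log.comp (M.measurable_div_q θ₀ θ).ennreal_toReal

lemma Q_eq_withDensity_div {θ₀ θ : Θ} {z : X × Y}
    (h : ∀ᵐ z' ∂(M.μ.prod M.ν), 0 < M.q θ z z') :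
    M.Q θ₀ z = (M.Q θ z).withDensity fun z' => M.q θ₀ z z' / M.q θ z z' := by
  have hm : Measurable fun z' => M.q θ₀ z z' / M.q θ z z' :=
    (M.measurable_div_q θ₀ θ).comp measurable_prodMk_left
  rw [M.Q_eq_withDensity, M.Q_eq_withDensity, ← withDensity_mul _ (M.measurable_q_right θ z) hm]
  refine withDensity_congr_ae ?_
  filter_upwards [h, M.ae_q_lt_top θ z] with z' h1 h2
  exact (ENNReal.mul_div_cancel h1.ne' h2.ne).symm

/-- The form with `klFun` has a nonnegative integrand, so it can be integrated over the initial
state by Tonelli without any integrability condition. -/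
lemma klDiv_Q {θ₀ θ : Θ} {z : X × Y} (h : ∀ᵐ z' ∂(M.μ.prod M.ν), 0 < M.q θ z z') :
    InformationTheory.klDiv (M.Q θ₀ z) (M.Q θ z) = ∫⁻ z', ENNReal.ofReal
      (InformationTheory.klFun (M.q θ₀ z z' / M.q θ z z').toReal) ∂M.Q θ z := by
  have hm : Measurable fun z' => M.q θ₀ z z' / M.q θ z z' :=
    (M.measurable_div_q θ₀ θ).comp measurable_prodMk_left
  have hac : M.Q θ₀ z ≪ M.Q θ z := (M.Q_absolutelyContinuous θ₀ z).trans (M.absolutelyContinuous_Q h)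
  rw [InformationTheory.klDiv_eq_lintegral_klFun_of_ac hac]
  refine lintegral_congr_ae ?_
  have := Measure.rnDeriv_withDensity (M.Q θ z) hm
  rw [← M.Q_eq_withDensity_div h] at this
  filter_upwards [this] with z' hz'
  rw [hz']

lemma compProd_Q_eq_withDensity {π : Measure (X × Y)} [IsProbabilityMeasure π] {θ₀ θ : Θ}
    (h : ∀ z, ∀ᵐ z' ∂(M.μ.prod M.ν), 0 < M.q θ z z') :
    π ⊗ₘ M.Q θ₀ = (π ⊗ₘ M.Q θ).withDensity fun p => M.q θ₀ p.1 p.2 / M.q θ p.1 p.2 := by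
  have hm := M.measurable_div_q θ₀ θ
  refine Measure.ext_of_lintegral _ fun F hF => ?_
  rw [lintegral_withDensity_eq_lintegral_mul _ hm hF, Measure.lintegral_compProd hF,
    Measure.lintegral_compProd (hm.mul hF)]
  refine lintegral_congr fun z => ?_
  have hm' : Measurable fun z' => M.q θ₀ z z' / M.q θ z z' := hm.comp measurable_prodMk_left
  have hF' : Measurable fun z' => F (z, z') := hF.comp measurable_prodMk_left
  rw [M.Q_eq_withDensity_div (θ₀ := θ₀) (h z), lintegral_withDensity_eq_lintegral_mul _ hm' hF']
  rfl

/-- The expected Kullback-Leibler divergence is the mean of the log-likelihood ratio. -/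
lemma integral_logRatio {π : Measure (X × Y)} [IsProbabilityMeasure π] {θ₀ θ : Θ}
    (h : ∀ z, ∀ᵐ z' ∂(M.μ.prod M.ν), 0 < M.q θ z z') (hfin : M.expectedKL π θ₀ θ ≠ ∞) :
    Integrable (M.logRatio θ₀ θ) (π ⊗ₘ M.Q θ₀) ∧
      ∫ p, M.logRatio θ₀ θ p ∂(π ⊗ₘ M.Q θ₀) = (M.expectedKL π θ₀ θ).toReal := by
  have hm := M.measurable_div_q θ₀ θ
  have hac : π ⊗ₘ M.Q θ₀ ≪ π ⊗ₘ M.Q θ := by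
    rw [M.compProd_Q_eq_withDensity (θ₀ := θ₀) h]; exact withDensity_absolutelyContinuous _ _
  have hrn : (π ⊗ₘ M.Q θ₀).rnDeriv (π ⊗ₘ M.Q θ) =ᵐ[π ⊗ₘ M.Q θ]
      fun p => M.q θ₀ p.1 p.2 / M.q θ p.1 p.2 := by
    rw [M.compProd_Q_eq_withDensity (θ₀ := θ₀) h]
    exact Measure.rnDeriv_withDensity (π ⊗ₘ M.Q θ) hm
  have hmk : Measurable fun p : (X × Y) × (X × Y) => ENNReal.ofReal
      (InformationTheory.klFun (M.q θ₀ p.1 p.2 / M.q θ p.1 p.2).toReal) :=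
    (InformationTheory.measurable_klFun.comp hm.ennreal_toReal).ennreal_ofReal
  -- Chain rule with a common first marginal: the divergence between the laws of `(Z_0, Z_1)` is the
  -- mean conditional divergence. Finiteness then yields integrability of the log-ratio.
  have hkl : InformationTheory.klDiv (π ⊗ₘ M.Q θ₀) (π ⊗ₘ M.Q θ) = M.expectedKL π θ₀ θ := by
    have hmk' : Measurable fun z => ∫⁻ z', ENNReal.ofReal
      (InformationTheory.klFun (M.q θ₀ z z' / M.q θ z z').toReal) ∂M.Q θ z :=
      hmk.lintegral_kernel_prod_right'
    rw [InformationTheory.klDiv_eq_lintegral_klFun_of_ac hac, expectedKL]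
    simp_rw [fun z => M.klDiv_Q (θ₀ := θ₀) (h z)]
    rw [← lintegral_map (f := fun z => ∫⁻ z', ENNReal.ofReal
      (InformationTheory.klFun (M.q θ₀ z z' / M.q θ z z').toReal) ∂M.Q θ z)
      (g := fun ω : ℕ → X × Y => ω 0) hmk' (by fun_prop), law, chainLaw_map_zero,
      ← Measure.lintegral_compProd hmk]
    refine lintegral_congr_ae ?_
    filter_upwards [hrn] with p hp
    rw [hp]
  have hllr : llr (π ⊗ₘ M.Q θ₀) (π ⊗ₘ M.Q θ) =ᵐ[π ⊗ₘ M.Q θ₀] M.logRatio θ₀ θ := by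
    filter_upwards [hac.ae_le hrn] with p hp
    rw [llr, hp, logRatio]
  rw [← hkl] at hfin ⊢
  refine ⟨(InformationTheory.klDiv_ne_top_iff.1 hfin).2.congr hllr, ?_⟩
  rw [InformationTheory.toReal_klDiv_of_measure_eq hac (by simp), integral_congr_ae hllr]

end FullyDominated

/-! ### Likelihood ratios for complete observations. -/

namespace FullyDominated

variable {Θ : Type u} {X : Type v} {Y : Type w}
  [MeasurableSpace Θ] [MeasurableSpace X] [MeasurableSpace Y] (M : FullyDominated Θ X Y)

/-- The density of `Z_1` for the chain started from `η`. -/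
noncomputable def firstDensity (η : Measure (X × Y)) (θ : Θ) (z : X × Y) : ℝ≥0∞ :=
  ∫⁻ z₀, M.q θ z₀ z ∂η

/-- The initial law enters only through the density of `Z_1`, so changing it costs a factor which
does not depend on `n`. -/
lemma stateDensity_succ (η : Measure (X × Y)) (θ : Θ) {n : ℕ} (z : Fin (n + 1) → X × Y) :
    M.stateDensity η θ z = M.firstDensity η θ (z 0) * pathProd (M.q θ) z := by
  have hm : Measurable fun z₀ => M.q θ z₀ (z 0) :=
    (M.measurable_uncurry_q θ).comp measurable_prodMk_right
  rw [stateDensity, firstDensity, ← lintegral_mul_const _ hm]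
  refine lintegral_congr fun z₀ => ?_
  simp only [pathProd]
  rw [Fin.prod_univ_succ]
  simp

lemma measurable_firstDensity (η : Measure (X × Y)) [SFinite η] (θ : Θ) :
    Measurable (M.firstDensity η θ) :=
  Measurable.lintegral_prod_left' (M.measurable_uncurry_q θ)

lemma lintegral_firstDensity (η : Measure (X × Y)) [IsProbabilityMeasure η] (θ : Θ) :
    ∫⁻ z, M.firstDensity η θ z ∂(M.μ.prod M.ν) = 1 := by
  unfold firstDensity
  have hm : Measurable (Function.uncurry fun z z₀ => M.q θ z₀ z) :=
    (M.measurable_uncurry_q θ).comp measurable_swap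
  rw [lintegral_lintegral_swap hm.aemeasurable]
  simp [lintegral_q]

lemma ae_firstDensity_lt_top (η : Measure (X × Y)) [IsProbabilityMeasure η] (θ : Θ) :
    ∀ᵐ z ∂(M.μ.prod M.ν), M.firstDensity η θ z < ∞ :=
  ae_lt_top (M.measurable_firstDensity η θ)
    (by rw [lintegral_firstDensity]; exact ENNReal.one_ne_top)

lemma ae_firstDensity_pos (η : Measure (X × Y)) [IsProbabilityMeasure η] {θ : Θ}
    (h : ∀ z, ∀ᵐ z' ∂(M.μ.prod M.ν), 0 < M.q θ z z') :
    ∀ᵐ z ∂(M.μ.prod M.ν), 0 < M.firstDensity η θ z := by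
  have hq := M.measurable_uncurry_q θ
  have hq' : ∀ z, Measurable fun z₀ => M.q θ z₀ z := fun z => hq.comp measurable_prodMk_right
  have h1 : ∀ᵐ p ∂(η.prod (M.μ.prod M.ν)), 0 < M.q θ p.1 p.2 :=
    (Measure.ae_prod_iff_ae_ae (measurableSet_lt measurable_const hq)).2 (ae_of_all _ h)
  have h2 : ∀ᵐ p ∂((M.μ.prod M.ν).prod η), 0 < M.q θ p.2 p.1 := by
    rw [← Measure.prod_swap] at h1
    exact ae_of_ae_map measurable_swap.aemeasurable h1
  filter_upwards [Measure.ae_ae_of_ae_prod h2] with z hz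
  rw [pos_iff_ne_zero, firstDensity, Ne, lintegral_eq_zero_iff (hq' z)]
  intro h0
  obtain ⟨z₀, h3, h4⟩ := (hz.and h0).exists
  exact h3.ne' h4

lemma q_eq_exp_neg_logRatio_mul {θ₀ θ : Θ} {z z' : X × Y}
    (h0 : M.q θ₀ z z' ≠ 0) (h0' : M.q θ₀ z z' ≠ ∞) (h1 : M.q θ z z' ≠ 0) (h1' : M.q θ z z' ≠ ∞) :
    M.q θ z z' = ENNReal.ofReal (Real.exp (-M.logRatio θ₀ θ (z, z'))) * M.q θ₀ z z' := by
  have hu0 : M.q θ₀ z z' / M.q θ z z' ≠ 0 := (ENNReal.div_pos h0 h1').ne'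
  have hu : M.q θ₀ z z' / M.q θ z z' ≠ ∞ := ENNReal.div_ne_top h0' h1
  rw [logRatio, Real.exp_neg, Real.exp_log (ENNReal.toReal_pos hu0 hu),
    ENNReal.ofReal_inv_of_pos (ENNReal.toReal_pos hu0 hu), ENNReal.ofReal_toReal hu,
    ENNReal.inv_div (Or.inl h1') (Or.inl h1), ENNReal.div_mul_cancel h0 h0']

lemma pathProd_eq_exp_mul {θ₀ θ : Θ} {n : ℕ} {z : Fin (n + 1) → X × Y}
    (h0 : ∀ i : Fin n, M.q θ₀ (z i.castSucc) (z i.succ) ≠ 0 ∧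
      M.q θ₀ (z i.castSucc) (z i.succ) ≠ ∞)
    (h1 : ∀ i : Fin n, M.q θ (z i.castSucc) (z i.succ) ≠ 0 ∧
      M.q θ (z i.castSucc) (z i.succ) ≠ ∞) :
    pathProd (M.q θ) z = ENNReal.ofReal
      (Real.exp (-∑ i : Fin n, M.logRatio θ₀ θ (z i.castSucc, z i.succ))) *
        pathProd (M.q θ₀) z := by
  unfold pathProd
  rw [← Finset.sum_neg_distrib, Real.exp_sum, ENNReal.ofReal_prod_of_nonneg
    (fun i _ => (Real.exp_pos _).le), ← Finset.prod_mul_distrib]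
  exact Finset.prod_congr rfl fun i _ =>
    M.q_eq_exp_neg_logRatio_mul (h0 i).1 (h0 i).2 (h1 i).1 (h1 i).2

/-- Along the chain with parameter `θ₀`, the log-likelihood ratio of the complete observations
does not grow faster than the expected Kullback-Leibler divergence. -/
theorem ae_eventually_stateDensity_ge {π η : Measure (X × Y)} [IsProbabilityMeasure π]
    [IsProbabilityMeasure η] {θ₀ θ : Θ} (hπ : (M.Q θ₀).Invariant π)
    (hpos : ∀ θ z, ∀ᵐ z' ∂(M.μ.prod M.ν), 0 < M.q θ z z') {δ : ℝ} (hδ : 0 < δ)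
    (hΔ : M.expectedKL π θ₀ θ ≤ ENNReal.ofReal δ) :
    ∀ᵐ ω ∂M.law θ₀ π, ∀ᶠ n : ℕ in atTop,
      ENNReal.ofReal (Real.exp (-(3 * δ * n))) * M.stateDensity π θ₀ (states n ω) ≤
        M.stateDensity η θ (states n ω) := by
  have hE : Ergodic (shiftBy 1) (M.law θ₀ π) :=
    ergodic_shiftBy_chainLaw hπ (M.Q_absolutelyContinuous θ₀)
      fun z => M.absolutelyContinuous_Q (hpos θ₀ z)
  have : IsProbabilityMeasure (M.law θ₀ π) := by unfold law; infer_instance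
  have hpair : (M.law θ₀ π).map (fun ω => (ω 0, ω 1)) = π ⊗ₘ M.Q θ₀ := chainLaw_map_pair _ _
  have hpm : Measurable fun ω : ℕ → X × Y => (ω 0, ω 1) := by fun_prop
  have hfin : M.expectedKL π θ₀ θ ≠ ∞ := ne_top_of_le_ne_top ENNReal.ofReal_ne_top hΔ
  obtain ⟨hint, hmean⟩ := M.integral_logRatio (hpos θ) hfin
  rw [← hpair] at hint hmean
  rw [integral_map hpm.aemeasurable (M.measurable_logRatio θ₀ θ).aestronglyMeasurable] at hmean
  have hint' : Integrable (fun ω : ℕ → X × Y => M.logRatio θ₀ θ (ω 0, ω 1)) (M.law θ₀ π) :=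
    hint.comp_measurable hpm
  -- The log-ratio has mean at most `δ`, so `f` has mean at least `δ`. Bounded-below Birkhoff sums
  -- of `f` say that the log-ratio over `n` transitions is at most `2δn` plus a random constant.
  let f : (ℕ → X × Y) → ℝ := fun ω => 2 * δ - M.logRatio θ₀ θ (ω 0, ω 1)
  have hfm : Measurable f := by unfold f; fun_prop
  have hfi : Integrable f (M.law θ₀ π) := (integrable_const _).sub hint'
  have hfpos : 0 < ∫ ω, f ω ∂M.law θ₀ π := by
    unfold f
    rw [integral_sub (integrable_const _) hint', hmean]
    have := ENNReal.toReal_mono ENNReal.ofReal_ne_top hΔ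
    rw [ENNReal.toReal_ofReal hδ.le] at this
    simp
    linarith
  -- The bound is needed along the shifted trajectory, because the path product starts with the
  -- transition from time `1` to time `2`.
  have hbirk := hE.quasiMeasurePreserving.ae (ae_bddBelow_birkhoffSum hE hfm hfi hfpos)
  have hgood : ∀ θ', ∀ᵐ ω ∂M.law θ₀ π, M.q θ' (ω 0) (ω 1) ≠ 0 ∧ M.q θ' (ω 0) (ω 1) ≠ ∞ := by
    intro θ'
    have hq := M.measurable_uncurry_q θ'
    refine ae_of_ae_map (p := fun p : (X × Y) × (X × Y) => M.q θ' p.1 p.2 ≠ 0 ∧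
      M.q θ' p.1 p.2 ≠ ∞) hpm.aemeasurable ?_
    rw [hpair]
    refine Measure.ae_compProd_of_ae_ae ?_ (ae_of_all _ fun z => ?_)
    · exact ((hq (measurableSet_singleton 0)).compl).inter ((hq (measurableSet_singleton ∞)).compl)
    · refine (M.Q_absolutelyContinuous θ₀ z).ae_le ?_
      filter_upwards [hpos θ' z, M.ae_q_lt_top θ' z] with z' h1 h2 using ⟨h1.ne', h2.ne⟩
  have hgood' : ∀ θ', ∀ᵐ ω ∂M.law θ₀ π, ∀ i,
      M.q θ' (ω (i + 1)) (ω (i + 2)) ≠ 0 ∧ M.q θ' (ω (i + 1)) (ω (i + 2)) ≠ ∞ := by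
    intro θ'
    rw [ae_all_iff]
    intro i
    have := (hE.quasiMeasurePreserving.iterate (i + 1)).ae (hgood θ')
    filter_upwards [this] with ω hω
    rw [shiftBy_one_iterate] at hω
    exact hω
  have hfirst : ∀ᵐ ω ∂M.law θ₀ π, M.firstDensity π θ₀ (ω 1) < ∞ ∧ 0 < M.firstDensity η θ (ω 1) := by
    refine ae_of_ae_map (f := fun ω : ℕ → X × Y => ω 1)
      (p := fun z => M.firstDensity π θ₀ z < ∞ ∧ 0 < M.firstDensity η θ z)
      (measurable_pi_apply 1).aemeasurable ?_
    rw [law, chainLaw_map_eval_one]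
    refine Measure.AbsolutelyContinuous.ae_le (ν := M.μ.prod M.ν) ?_
      ((M.ae_firstDensity_lt_top π θ₀).and (M.ae_firstDensity_pos η (hpos θ)))
    refine Measure.AbsolutelyContinuous.mk fun s hs h0 => ?_
    rw [Measure.bind_apply hs (Kernel.aemeasurable _)]
    simp [fun z => M.Q_absolutelyContinuous θ₀ z h0]
  filter_upwards [hbirk, hgood' θ₀, hgood' θ, hfirst] with ω ⟨k, hk⟩ h0 h1 ⟨hf1, hf2⟩
  have hsum : ∀ n : ℕ, ∑ i : Fin n, M.logRatio θ₀ θ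
      (states (n + 1) ω i.castSucc, states (n + 1) ω i.succ) ≤ k + 2 * δ * n := by
    intro n
    have := hk n
    unfold birkhoffSum at this
    simp only [f, Finset.sum_sub_distrib, Finset.sum_const, Finset.card_range, nsmul_eq_mul,
      ← Function.iterate_succ_apply, shiftBy_one_iterate] at this
    rw [Finset.sum_range] at this
    have e : ∀ i : Fin n, (states (n + 1) ω i.castSucc, states (n + 1) ω i.succ) =
        (shiftBy (Nat.succ i) ω 0, shiftBy (Nat.succ i) ω 1) := fun i => rfl
    simp only [e]
    linarith
  -- The minimum with `1` and the added `1` keep the quotient finite and its denominator nonzero,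
  -- whatever the values of the two densities of `Z_1`.
  obtain ⟨c, hc0, hc⟩ : ∃ c : ℝ, 0 < c ∧
      ENNReal.ofReal c * M.firstDensity π θ₀ (ω 1) ≤ M.firstDensity η θ (ω 1) := by
    have hd0 : min 1 (M.firstDensity η θ (ω 1)) / (M.firstDensity π θ₀ (ω 1) + 1) ≠ 0 :=
      (ENNReal.div_pos (lt_min one_pos hf2).ne' (by finiteness)).ne'
    have hd1 : min 1 (M.firstDensity η θ (ω 1)) / (M.firstDensity π θ₀ (ω 1) + 1) ≠ ∞ :=
      ENNReal.div_ne_top (ne_top_of_le_ne_top ENNReal.one_ne_top (min_le_left _ _)) (by simp)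
    refine ⟨_, ENNReal.toReal_pos hd0 hd1, ?_⟩
    rw [ENNReal.ofReal_toReal hd1]
    calc _ ≤ min 1 (M.firstDensity η θ (ω 1)) / (M.firstDensity π θ₀ (ω 1) + 1) *
          (M.firstDensity π θ₀ (ω 1) + 1) := by gcongr; exact le_self_add
      _ = min 1 (M.firstDensity η θ (ω 1)) := ENNReal.div_mul_cancel (by simp) (by finiteness)
      _ ≤ _ := min_le_right _ _
  -- The third `δ` in the exponent absorbs the random constants `k` and `log c`.
  have hev : ∀ᶠ n : ℕ in atTop, k - Real.log c ≤ δ * n := by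
    obtain ⟨N, hN⟩ := exists_nat_ge ((k - Real.log c) / δ)
    filter_upwards [eventually_ge_atTop N] with n hn
    have : (N : ℝ) ≤ n := by exact_mod_cast hn
    rw [div_le_iff₀ hδ] at hN
    nlinarith
  filter_upwards [hev, eventually_ge_atTop 1] with n hn hn1
  obtain ⟨n, rfl⟩ : ∃ l, n = l + 1 := ⟨n - 1, by omega⟩
  have hreal : Real.exp (-(3 * δ * ((n + 1 : ℕ) : ℝ))) ≤
      c * Real.exp (-∑ i : Fin n, M.logRatio θ₀ θ
        (states (n + 1) ω i.castSucc, states (n + 1) ω i.succ)) := by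
    rw [← Real.exp_log hc0, ← Real.exp_add]
    refine Real.exp_le_exp.2 ?_
    have := hsum n
    push_cast at hn ⊢
    linarith
  rw [stateDensity_succ, stateDensity_succ,
    M.pathProd_eq_exp_mul (θ₀ := θ₀) (θ := θ) (fun i => h0 i) (fun i => h1 i)]
  have e0 : states (n + 1) ω 0 = ω 1 := rfl
  rw [e0]
  calc _ ≤ ENNReal.ofReal c * ENNReal.ofReal (Real.exp (-∑ i : Fin n, M.logRatio θ₀ θ
        (states (n + 1) ω i.castSucc, states (n + 1) ω i.succ))) *
        (M.firstDensity π θ₀ (ω 1) * pathProd (M.q θ₀) (states (n + 1) ω)) := by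
        rw [← ENNReal.ofReal_mul hc0.le]
        gcongr
    _ = (ENNReal.ofReal c * M.firstDensity π θ₀ (ω 1)) * (ENNReal.ofReal (Real.exp
        (-∑ i : Fin n, M.logRatio θ₀ θ (states (n + 1) ω i.castSucc, states (n + 1) ω i.succ))) *
        pathProd (M.q θ₀) (states (n + 1) ω)) := by ring
    _ ≤ _ := by gcongr

end FullyDominated

/-! ### Lower bound on the integrated likelihood. -/

namespace FullyDominated

variable {Θ : Type u} {X : Type v} {Y : Type w}
  [MeasurableSpace Θ] [MeasurableSpace X] [MeasurableSpace Y] (M : FullyDominated Θ X Y)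

instance (θ : Θ) (η : Measure (X × Y)) [IsProbabilityMeasure η] :
    IsProbabilityMeasure (M.law θ η) := by
  unfold law; infer_instance

@[fun_prop]
lemma measurable_lintegral_likelihood (η : Measure (X × Y)) [SFinite η] (ρ : Measure Θ) [SFinite ρ]
    {n : ℕ} : Measurable fun y : Fin n → Y => ∫⁻ θ, M.likelihood η θ y ∂ρ :=
  Measurable.lintegral_prod_left' (M.measurable_likelihood_joint η)

@[fun_prop]
lemma measurable_lintegral_stateDensity (η : Measure (X × Y)) [SFinite η] (ρ : Measure Θ)
    [SFinite ρ] {n : ℕ} : Measurable fun z : Fin n → X × Y => ∫⁻ θ, M.stateDensity η θ z ∂ρ :=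
  Measurable.lintegral_prod_left' (M.measurable_stateDensity_joint η)

lemma lintegral_likelihood_eq (η : Measure (X × Y)) [SFinite η] (ρ : Measure Θ) [SFinite ρ]
    {n : ℕ} (y : Fin n → Y) :
    ∫⁻ θ, M.likelihood η θ y ∂ρ =
      ∫⁻ x, ∫⁻ θ, M.stateDensity η θ (joinObs y x) ∂ρ ∂Measure.pi fun _ => M.μ := by
  simp_rw [likelihood_eq_lintegral]
  refine lintegral_lintegral_swap (Measurable.aemeasurable ?_)
  exact (M.measurable_stateDensity_joint η).comp (by fun_prop : Measurable
    fun p : Θ × (Fin n → X) => (p.1, joinObs y p.2))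

/-- The mixture density of the states dominates, up to a subexponential factor, the density under
`θ₀`, as soon as the mixing measure charges the Kullback-Leibler neighbourhoods of `θ₀`. -/
lemma ae_eventually_lintegral_stateDensity_ge {π η : Measure (X × Y)} [IsProbabilityMeasure π]
    [IsProbabilityMeasure η] {θ₀ : Θ} (hπ : (M.Q θ₀).Invariant π)
    (hpos : ∀ θ z, ∀ᵐ z' ∂(M.μ.prod M.ν), 0 < M.q θ z z') {ρ : Measure Θ} [IsFiniteMeasure ρ]
    {δ : ℝ} (hδ : 0 < δ) (hρ : 0 < ρ {θ | M.expectedKL π θ₀ θ ≤ ENNReal.ofReal δ}) :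
    ∀ᵐ ω ∂M.law θ₀ π, ∀ᶠ n : ℕ in atTop,
      ENNReal.ofReal (Real.exp (-(4 * δ * n))) * M.stateDensity π θ₀ (states n ω) ≤
        ∫⁻ θ, M.stateDensity η θ (states n ω) ∂ρ := by
  let E : ℕ → Set (Θ × (ℕ → X × Y)) := fun n => {p |
    ENNReal.ofReal (Real.exp (-(3 * δ * n))) * M.stateDensity π θ₀ (states n p.2) ≤
      M.stateDensity η p.1 (states n p.2)}
  have hE : ∀ n, MeasurableSet (E n) := fun n => by
    refine measurableSet_le ?_ ?_
    · exact ((M.measurable_stateDensity π θ₀).comp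
        ((measurable_states n).comp measurable_snd)).const_mul _
    · exact (M.measurable_stateDensity_joint η).comp (by fun_prop : Measurable
        fun p : Θ × (ℕ → X × Y) => (p.1, states n p.2))
  let B : ℕ → Set (Θ × (ℕ → X × Y)) := fun N => ⋂ n ≥ N, E n
  have hB : ∀ N, MeasurableSet (B N) := fun N =>
    MeasurableSet.iInter fun n => MeasurableSet.iInter fun _ => hE n
  let G : Set (Θ × (ℕ → X × Y)) := ⋃ N, B N
  have hG : MeasurableSet G := MeasurableSet.iUnion hB
  -- These are the parameters for which the bound eventually holds almost surely. The set contains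
  -- the Kullback-Leibler neighbourhood and is measurable by construction, which allows Fubini.
  let A : Set Θ := {θ | M.law θ₀ π (Prod.mk θ ⁻¹' Gᶜ) = 0}
  have hA : MeasurableSet A :=
    measurable_measure_prodMk_left hG.compl (measurableSet_singleton 0)
  have hρA : 0 < ρ A := by
    refine hρ.trans_le (measure_mono fun θ hθ => ?_)
    have h := M.ae_eventually_stateDensity_ge (η := η) hπ hpos hδ hθ
    refine measure_eq_zero_iff_ae_notMem.2 ?_
    filter_upwards [h] with ω hω
    obtain ⟨N, hN⟩ := eventually_atTop.1 hω
    simp only [Set.mem_preimage, Set.mem_compl_iff, not_not]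
    exact Set.mem_iUnion.2 ⟨N, Set.mem_iInter₂.2 hN⟩
  have h1 : ∀ᵐ p ∂((ρ.restrict A).prod (M.law θ₀ π)), p ∈ G := by
    refine (Measure.ae_prod_iff_ae_ae (p := fun p => p ∈ G) hG).2 ?_
    filter_upwards [ae_restrict_mem hA] with θ hθ
    have := measure_eq_zero_iff_ae_notMem.1 hθ
    filter_upwards [this] with ω hω
    simpa using hω
  have h2 : ∀ᵐ p ∂((M.law θ₀ π).prod (ρ.restrict A)), p.swap ∈ G := by
    rw [← Measure.prod_swap] at h1
    exact ae_of_ae_map measurable_swap.aemeasurable h1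
  filter_upwards [Measure.ae_ae_of_ae_prod h2] with ω hω
  -- For this trajectory almost every parameter of `A` obeys the bound from some rank on; by
  -- countable additivity a set of positive mass shares a common rank `N`.
  have hN : ∃ N, ρ {θ | (θ, ω) ∈ B N} ≠ 0 := by
    by_contra! hcon
    have h0 : ρ (⋃ N, {θ | (θ, ω) ∈ B N}) = 0 := measure_iUnion_null hcon
    have h3 : (ρ.restrict A) (⋃ N, {θ | (θ, ω) ∈ B N}) = 0 :=
      le_antisymm ((Measure.restrict_apply_le _ _).trans h0.le) zero_le
    have h4 := measure_eq_zero_iff_ae_notMem.1 h3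
    have h5 : ∀ᵐ θ ∂ρ.restrict A, False := by
      filter_upwards [hω, h4] with θ h6 h7
      refine h7 ?_
      obtain ⟨N, hN⟩ := Set.mem_iUnion.1 h6
      exact Set.mem_iUnion.2 ⟨N, hN⟩
    rw [ae_iff] at h5
    simp at h5
    exact hρA.ne' h5
  obtain ⟨N, hN⟩ := hN
  have hc0 : 0 < (ρ {θ | (θ, ω) ∈ B N}).toReal := ENNReal.toReal_pos hN (measure_ne_top _ _)
  -- The fixed positive mass of that set is absorbed by passing from `3δ` to `4δ`.
  have hev : ∀ᶠ n : ℕ in atTop, -Real.log (ρ {θ | (θ, ω) ∈ B N}).toReal ≤ δ * n := by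
    obtain ⟨K, hK⟩ := exists_nat_ge (-Real.log (ρ {θ | (θ, ω) ∈ B N}).toReal / δ)
    filter_upwards [eventually_ge_atTop K] with n hn
    have : (K : ℝ) ≤ n := by exact_mod_cast hn
    rw [div_le_iff₀ hδ] at hK
    nlinarith
  filter_upwards [hev, eventually_ge_atTop N] with n hn hnN
  have hexp : ENNReal.ofReal (Real.exp (-(4 * δ * n))) ≤
      ENNReal.ofReal (Real.exp (-(3 * δ * n))) * ρ {θ | (θ, ω) ∈ B N} := by
    rw [← ENNReal.ofReal_toReal (measure_ne_top ρ {θ | (θ, ω) ∈ B N}),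
      ← ENNReal.ofReal_mul (Real.exp_pos _).le]
    refine ENNReal.ofReal_le_ofReal ?_
    rw [← Real.exp_log hc0, ← Real.exp_add]
    exact Real.exp_le_exp.2 (by linarith)
  have hmark := mul_meas_ge_le_lintegral (μ := ρ) (f := fun θ => M.stateDensity η θ (states n ω))
    ((M.measurable_stateDensity_joint η).comp measurable_prodMk_right)
    (ENNReal.ofReal (Real.exp (-(3 * δ * n))) * M.stateDensity π θ₀ (states n ω))
  refine le_trans ?_ hmark
  calc _ ≤ ENNReal.ofReal (Real.exp (-(3 * δ * n))) * ρ {θ | (θ, ω) ∈ B N} *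
        M.stateDensity π θ₀ (states n ω) := by gcongr
    _ = ENNReal.ofReal (Real.exp (-(3 * δ * n))) * M.stateDensity π θ₀ (states n ω) *
        ρ {θ | (θ, ω) ∈ B N} := by ring
    _ ≤ _ := by
      gcongr
      exact fun hθ => Set.mem_iInter₂.1 hθ n hnN

lemma ofReal_exp_neg_mul_nat (δ : ℝ) (n : ℕ) :
    ENNReal.ofReal (Real.exp (-(δ * n))) = ENNReal.ofReal (Real.exp (-δ)) ^ n := by
  rw [← ENNReal.ofReal_pow (Real.exp_pos _).le, ← Real.exp_nat_mul]
  congr 2; ring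

/-- Passing from complete to partial observations only costs a small exponential factor. -/
lemma measure_likelihood_lt_le {π η : Measure (X × Y)} [IsProbabilityMeasure π]
    [IsProbabilityMeasure η] (θ₀ : Θ) (ρ : Measure Θ) [IsFiniteMeasure ρ] (δ : ℝ) (n : ℕ) :
    M.law θ₀ π {ω | ∫⁻ θ, M.likelihood η θ (obs n ω) ∂ρ <
        ENNReal.ofReal (Real.exp (-(2 * δ * n))) * M.likelihood π θ₀ (obs n ω) ∧
      ENNReal.ofReal (Real.exp (-(δ * n))) * M.stateDensity π θ₀ (states n ω) ≤
        ∫⁻ θ, M.stateDensity η θ (states n ω) ∂ρ} ≤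
      ENNReal.ofReal (Real.exp (-(δ * n))) := by
  let D : Set (Fin n → X × Y) := {z | ∫⁻ θ, M.likelihood η θ (fun i => (z i).2) ∂ρ <
        ENNReal.ofReal (Real.exp (-(2 * δ * n))) * M.likelihood π θ₀ (fun i => (z i).2) ∧
      ENNReal.ofReal (Real.exp (-(δ * n))) * M.stateDensity π θ₀ z ≤
        ∫⁻ θ, M.stateDensity η θ z ∂ρ}
  have hsnd : Measurable fun z : Fin n → X × Y => fun i => (z i).2 := by fun_prop
  have hD : MeasurableSet D := by
    have a₁ := (M.measurable_lintegral_likelihood η ρ).comp hsnd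
    have a₂ := ((M.measurable_likelihood π θ₀).comp hsnd).const_mul
      (ENNReal.ofReal (Real.exp (-(2 * δ * n))))
    have a₃ := (M.measurable_stateDensity π θ₀ (n := n)).const_mul
      (ENNReal.ofReal (Real.exp (-(δ * n))))
    have a₄ := M.measurable_lintegral_stateDensity η ρ (n := n)
    exact (measurableSet_lt a₁ a₂).inter (measurableSet_le a₃ a₄)
  have hDm : Measurable (D.indicator (1 : (Fin n → X × Y) → ℝ≥0∞)) := measurable_one.indicator hD
  have hlaw : M.law θ₀ π (states n ⁻¹' D) = ∫⁻ ω, D.indicator 1 (states n ω) ∂M.law θ₀ π := by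
    rw [← lintegral_indicator_one (measurable_states n hD)]
    rfl
  have hexp : ∀ a : ℝ≥0∞, ENNReal.ofReal (Real.exp (δ * n)) *
      (ENNReal.ofReal (Real.exp (-(δ * n))) * a) = a := fun a => by
    rw [← mul_assoc, ← ENNReal.ofReal_mul (Real.exp_pos _).le, ← Real.exp_add]
    simp
  have hexp2 : ENNReal.ofReal (Real.exp (δ * n)) * ENNReal.ofReal (Real.exp (-(2 * δ * n))) =
      ENNReal.ofReal (Real.exp (-(δ * n))) := by
    rw [← ENNReal.ofReal_mul (Real.exp_pos _).le, ← Real.exp_add]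
    congr 2; ring
  change M.law θ₀ π (states n ⁻¹' D) ≤ _
  rw [hlaw, M.lintegral_states θ₀ π hDm, M.lintegral_pi_joinObs (by fun_prop)]
  have hone : ∫⁻ y, M.likelihood π θ₀ y ∂Measure.pi (fun _ : Fin n => M.ν) = 1 := by
    have := M.lintegral_obs θ₀ π (n := n) (F := fun _ => 1) measurable_const
    simpa using this.symm
  calc _ ≤ ∫⁻ y, ENNReal.ofReal (Real.exp (-(δ * n))) * M.likelihood π θ₀ y
        ∂Measure.pi (fun _ : Fin n => M.ν) := by
        refine lintegral_mono fun y => ?_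
        -- For such `y`, the second condition in `D` bounds the state density by `exp(δn)` times the
        -- mixture density. Integrating over the hidden states and using `hy` leaves `exp(δn)
        -- exp(-2δn) = exp(-δn)` times the likelihood of `y`.
        by_cases hy : ∫⁻ θ, M.likelihood η θ y ∂ρ <
            ENNReal.ofReal (Real.exp (-(2 * δ * n))) * M.likelihood π θ₀ y
        · calc ∫⁻ x, D.indicator 1 (joinObs y x) * M.stateDensity π θ₀ (joinObs y x)
                ∂Measure.pi (fun _ => M.μ)
              ≤ ∫⁻ x, ENNReal.ofReal (Real.exp (δ * n)) *
                ∫⁻ θ, M.stateDensity η θ (joinObs y x) ∂ρ ∂Measure.pi (fun _ => M.μ) := by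
                refine lintegral_mono fun x => ?_
                by_cases hx : joinObs y x ∈ D
                · rw [Set.indicator_of_mem hx, Pi.one_apply, one_mul,
                    ← hexp (M.stateDensity π θ₀ (joinObs y x))]
                  gcongr
                  exact hx.2
                · rw [Set.indicator_of_notMem hx, zero_mul]
                  exact zero_le
            _ = ENNReal.ofReal (Real.exp (δ * n)) * ∫⁻ θ, M.likelihood η θ y ∂ρ := by
                have hm : Measurable fun x => ∫⁻ θ, M.stateDensity η θ (joinObs y x) ∂ρ :=
                  (M.measurable_lintegral_stateDensity η ρ).comp (measurable_joinObs_right y)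
                rw [lintegral_const_mul _ hm, M.lintegral_likelihood_eq]
            _ ≤ ENNReal.ofReal (Real.exp (δ * n)) *
                (ENNReal.ofReal (Real.exp (-(2 * δ * n))) * M.likelihood π θ₀ y) := by gcongr
            _ = _ := by rw [← mul_assoc, hexp2]
        · have : ∀ x, D.indicator (1 : (Fin n → X × Y) → ℝ≥0∞) (joinObs y x) = 0 := fun x =>
            Set.indicator_of_notMem (fun hx => hy hx.1) _
          simp [this]
    _ = ENNReal.ofReal (Real.exp (-(δ * n))) := by
        rw [lintegral_const_mul _ (M.measurable_likelihood π θ₀), hone, mul_one]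

/-- Lower bound on the integrated likelihood. -/
theorem ae_eventually_lintegral_likelihood_ge {π η : Measure (X × Y)} [IsProbabilityMeasure π]
    [IsProbabilityMeasure η] {θ₀ : Θ} (hπ : (M.Q θ₀).Invariant π)
    (hpos : ∀ θ z, ∀ᵐ z' ∂(M.μ.prod M.ν), 0 < M.q θ z z') {ρ : Measure Θ} [IsFiniteMeasure ρ]
    (hρ : ∀ δ : ℝ, 0 < δ → 0 < ρ {θ | M.expectedKL π θ₀ θ ≤ ENNReal.ofReal δ})
    {δ : ℝ} (hδ : 0 < δ) :
    ∀ᵐ ω ∂M.law θ₀ π, ∀ᶠ n : ℕ in atTop,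
      ENNReal.ofReal (Real.exp (-(δ * n))) * M.likelihood π θ₀ (obs n ω) ≤
        ∫⁻ θ, M.likelihood η θ (obs n ω) ∂ρ := by
  -- With `δ / 8` the complete-data loss is `exp(-δn/2)`; the passage to partial observations
  -- doubles the exponent to `δn`.
  have h1 := M.ae_eventually_lintegral_stateDensity_ge (η := η) (ρ := ρ) hπ hpos
    (δ := δ / 8) (by positivity) (hρ _ (by positivity))
  have hsum : ∑' n : ℕ, M.law θ₀ π {ω | ∫⁻ θ, M.likelihood η θ (obs n ω) ∂ρ <
        ENNReal.ofReal (Real.exp (-(2 * (δ / 2) * n))) * M.likelihood π θ₀ (obs n ω) ∧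
      ENNReal.ofReal (Real.exp (-((δ / 2) * n))) * M.stateDensity π θ₀ (states n ω) ≤
        ∫⁻ θ, M.stateDensity η θ (states n ω) ∂ρ} ≠ ∞ := by
    refine ne_top_of_le_ne_top ?_ (ENNReal.tsum_le_tsum fun n =>
      M.measure_likelihood_lt_le (π := π) (η := η) θ₀ ρ (δ / 2) n)
    simp_rw [ofReal_exp_neg_mul_nat]
    rw [ENNReal.tsum_geometric]
    refine ENNReal.inv_ne_top.2 (tsub_pos_of_lt ?_).ne'
    rw [ENNReal.ofReal_lt_one, Real.exp_lt_one_iff]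
    linarith
  -- Borel-Cantelli: the failure probabilities are dominated by a geometric series.
  filter_upwards [h1, ae_eventually_notMem hsum] with ω h2 h3
  filter_upwards [h2, h3] with n h4 h5
  replace h5 := not_and'.1 h5
  have e1 : 4 * (δ / 8) * (n : ℝ) = δ / 2 * n := by ring
  have e2 : 2 * (δ / 2) * (n : ℝ) = δ * n := by ring
  rw [e1] at h4
  have := not_lt.1 (h5 h4)
  rwa [e2] at this

end FullyDominated

/-! ### Measurable selection through independent sampling. -/

section Selection

variable {E Θ : Type*} [MeasurableSpace E] [MeasurableSpace Θ]

/-- The first `n` independent draws all miss `A` with probability `(ρ Aᶜ) ^ n`, which tends to `0`.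
-/
lemma infinitePi_forall_notMem {ρ : Measure Θ} [IsProbabilityMeasure ρ] {A : Set Θ}
    (hA : MeasurableSet A) (h0 : ρ A ≠ 0) :
    Measure.infinitePi (fun _ : ℕ => ρ) {t | ∀ k, t k ∉ A} = 0 := by
  have hlt : ρ Aᶜ < 1 := by
    rw [prob_compl_eq_one_sub hA]
    exact ENNReal.sub_lt_self ENNReal.one_ne_top one_ne_zero h0
  refine le_antisymm (ge_of_tendsto' (ENNReal.tendsto_pow_atTop_nhds_zero_of_lt_one hlt)
    fun n => ?_) zero_le
  calc _ ≤ Measure.infinitePi (fun _ : ℕ => ρ) (Set.pi (Finset.range n) fun _ => Aᶜ) :=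
        measure_mono (by intro t ht k _; exact ht k)
    _ = ρ Aᶜ ^ n := by
        rw [Measure.infinitePi_pi _ fun _ _ => hA.compl]
        simp

/-- For a jointly measurable set `S`, there is a countable family which meets almost every section
of `S` of positive measure. -/
lemma exists_seq_mem_section (P : Measure E) [SFinite P] (ρ : Measure Θ)
    [IsFiniteMeasure ρ] [Nonempty Θ] {S : Set (E × Θ)} (hS : MeasurableSet S) :
    ∃ t : ℕ → Θ, ∀ᵐ y ∂P, ρ (Prod.mk y ⁻¹' S) ≠ 0 → ∃ k, (y, t k) ∈ S := by
  rcases eq_or_ne ρ 0 with rfl | hρ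
  · exact ⟨fun _ => Classical.arbitrary Θ, ae_of_all _ fun y h => absurd (by simp) h⟩
  have : NeZero ρ := ⟨hρ⟩
  let ρ' : Measure Θ := (ρ Set.univ)⁻¹ • ρ
  have : IsProbabilityMeasure ρ' := by unfold ρ'; infer_instance
  have hρ' : ∀ A, ρ A ≠ 0 → ρ' A ≠ 0 := fun A hA => by
    simp only [ρ', Measure.smul_apply, smul_eq_mul]
    exact mul_ne_zero (ENNReal.inv_ne_zero.2 (measure_ne_top _ _)) hA
  have hSk : ∀ k, MeasurableSet {p : E × (ℕ → Θ) | (p.1, p.2 k) ∈ S} := fun k =>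
    (by fun_prop : Measurable fun p : E × (ℕ → Θ) => (p.1, p.2 k)) hS
  have hm : MeasurableSet {p : E × (ℕ → Θ) |
      ρ (Prod.mk p.1 ⁻¹' S) ≠ 0 → ∃ k, (p.1, p.2 k) ∈ S} := by
    have h1 : MeasurableSet {p : E × (ℕ → Θ) | ρ (Prod.mk p.1 ⁻¹' S) = 0} :=
      ((measurable_measure_prodMk_left hS).comp measurable_fst) (measurableSet_singleton 0)
    have h2 := h1.union (MeasurableSet.iUnion hSk)
    convert h2 using 1
    ext p
    simp only [Set.mem_ofPred_eq, Set.mem_union, Set.mem_iUnion]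
    tauto
  -- For each `y` with a section of positive measure, almost every i.i.d. sequence meets that
  -- section. By Fubini almost every sequence, hence at least one, works for almost every `y`.
  have hprod : ∀ᵐ p ∂(P.prod (Measure.infinitePi fun _ : ℕ => ρ')),
      ρ (Prod.mk p.1 ⁻¹' S) ≠ 0 → ∃ k, (p.1, p.2 k) ∈ S := by
    rw [Measure.ae_prod_iff_ae_ae hm]
    refine ae_of_all _ fun y => ?_
    by_cases hy : ρ (Prod.mk y ⁻¹' S) = 0
    · exact ae_of_all _ fun t h => absurd hy h
    · have := measure_eq_zero_iff_ae_notMem.1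
        (infinitePi_forall_notMem (measurable_prodMk_left hS) (hρ' _ hy))
      filter_upwards [this] with t ht _
      by_contra! hcon
      exact ht hcon
  have hswap : ∀ᵐ p ∂((Measure.infinitePi fun _ : ℕ => ρ').prod P),
      ρ (Prod.mk p.2 ⁻¹' S) ≠ 0 → ∃ k, (p.2, p.1 k) ∈ S := by
    rw [← Measure.prod_swap] at hprod
    exact ae_of_ae_map measurable_swap.aemeasurable hprod
  exact (Measure.ae_ae_of_ae_prod hswap).exists

/-- A measurable selection from the sections of positive measure, outside a null set. -/
lemma exists_measurable_selection (P : Measure E) [SFinite P] (ρ : Measure Θ)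
    [IsFiniteMeasure ρ] (θ₀ : Θ) {S : Set (E × Θ)} (hS : MeasurableSet S) :
    ∃ s : E → Θ, Measurable s ∧ (∀ y, s y = θ₀ ∨ (y, s y) ∈ S) ∧
      ∀ᵐ y ∂P, ρ (Prod.mk y ⁻¹' S) ≠ 0 → (y, s y) ∈ S := by
  classical
  have : Nonempty Θ := ⟨θ₀⟩
  obtain ⟨t, ht⟩ := exists_seq_mem_section P ρ hS
  have hSk : ∀ k, MeasurableSet {y : E | (y, t k) ∈ S} := fun k => measurable_prodMk_right hS
  -- The second alternative makes the search for a first index always terminate; when it is the one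
  -- met, the selection takes the default value `θ₀`.
  let p : ℕ → E → Prop := fun n y => (y, t n) ∈ S ∨ ∀ k, (y, t k) ∉ S
  have hp : ∀ y, ∃ n, p n y := fun y => by
    by_cases h : ∃ n, (y, t n) ∈ S
    · exact ⟨h.choose, Or.inl h.choose_spec⟩
    · exact ⟨0, Or.inr (not_exists.1 h)⟩
  have hpm : ∀ n, MeasurableSet {y | p n y} := fun n => by
    have := (hSk n).union (MeasurableSet.iInter fun k => (hSk k).compl)
    convert this using 1
    ext y
    simp [p]
  let f : ℕ → E → Θ := fun n y => if (y, t n) ∈ S then t n else θ₀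
  have hf : ∀ n, Measurable (f n) := fun n =>
    Measurable.ite (hSk n) measurable_const measurable_const
  refine ⟨fun y => f (Nat.find (hp y)) y, Measurable.find hf hpm hp, fun y => ?_, ?_⟩
  · by_cases h : (y, t (Nat.find (hp y))) ∈ S
    · right; simp only [f, if_pos h]; exact h
    · left; simp only [f, if_neg h]
  · filter_upwards [ht] with y hy hρ
    have h : (y, t (Nat.find (hp y))) ∈ S := by
      rcases Nat.find_spec (hp y) with h | h
      · exact h
      · exact absurd (hy hρ) (not_exists.2 h)
    simp only [f, if_pos h]
    exact h

end Selection

/-! ### The adaptive level. -/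

section Counter

variable {Y : Type*}

open Classical in
/-- The counter which increases by one each time the observations `y` up to time `n` lie in the
set `A n k`, where `k` is the current value. -/
noncomputable def counter (A : (n : ℕ) → ℕ → Set (Fin n → Y)) : (n : ℕ) → (Fin n → Y) → ℕ
  | 0, _ => 0
  | n + 1, y =>
    if (fun i : Fin n => y i.castSucc) ∈ A n (counter A n fun i => y i.castSucc) then
      counter A n (fun i => y i.castSucc) + 1
    else counter A n fun i => y i.castSucc

lemma measurableSet_counter [MeasurableSpace Y] {A : (n : ℕ) → ℕ → Set (Fin n → Y)}
    (hA : ∀ n k, MeasurableSet (A n k)) {n : ℕ} (hc : Measurable (counter A n)) :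
    MeasurableSet {y | y ∈ A n (counter A n y)} := by
  have : {y | y ∈ A n (counter A n y)} = ⋃ k, A n k ∩ counter A n ⁻¹' {k} := by
    ext y; simp
  rw [this]
  exact MeasurableSet.iUnion fun k => (hA n k).inter (hc (measurableSet_singleton k))

lemma measurable_counter [MeasurableSpace Y] {A : (n : ℕ) → ℕ → Set (Fin n → Y)}
    (hA : ∀ n k, MeasurableSet (A n k)) (n : ℕ) : Measurable (counter A n) := by
  induction n with
  | zero => exact measurable_const
  | succ n ih =>
    have hr : Measurable fun y : Fin (n + 1) → Y => fun i : Fin n => y i.castSucc := by fun_prop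
    exact Measurable.ite (hr (measurableSet_counter hA ih)) ((ih.comp hr).add_const 1)
      (ih.comp hr)

end Counter

/-! ### Change of initial law; finiteness and positivity of likelihoods. -/

namespace FullyDominated

variable {Θ : Type u} {X : Type v} {Y : Type w}
  [MeasurableSpace Θ] [MeasurableSpace X] [MeasurableSpace Y] (M : FullyDominated Θ X Y)

/-- By positivity, the law of `Z_1` is equivalent to `μ ⊗ ν` for every initial law, and the law of
the trajectory from time `1` depends on the initial law only through that of `Z_1`. -/
lemma map_shiftBy_law_absolutelyContinuous {θ : Θ} (η η' : Measure (X × Y))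
    [IsProbabilityMeasure η] [IsProbabilityMeasure η']
    (hpos : ∀ z, ∀ᵐ z' ∂(M.μ.prod M.ν), 0 < M.q θ z z') :
    (M.law θ η').map (shiftBy 1) ≪ (M.law θ η).map (shiftBy 1) := by
  rw [law, law, chainLaw_map_shiftBy_one, chainLaw_map_shiftBy_one]
  refine chainLaw_absolutelyContinuous _ (Measure.AbsolutelyContinuous.mk fun s hs h0 => ?_)
  rw [Measure.bind_apply hs (Kernel.aemeasurable _),
    lintegral_eq_zero_iff (Kernel.measurable_coe _ hs)] at *
  obtain ⟨z, hz⟩ := h0.exists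
  have := M.absolutelyContinuous_Q (hpos z) hz
  exact ae_of_all _ fun z' => M.Q_absolutelyContinuous θ z' this

/-- An almost sure property of the states from time `1` on does not depend on the initial law. -/
lemma ae_shiftBy_of_ae_shiftBy {θ : Θ} {η η' : Measure (X × Y)}
    [IsProbabilityMeasure η] [IsProbabilityMeasure η']
    (hpos : ∀ z, ∀ᵐ z' ∂(M.μ.prod M.ν), 0 < M.q θ z z') {D : Set (ℕ → X × Y)}
    (hD : MeasurableSet D) (h : ∀ᵐ ω ∂M.law θ η, shiftBy 1 ω ∈ D) :
    ∀ᵐ ω ∂M.law θ η', shiftBy 1 ω ∈ D :=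
  ae_of_ae_map (measurable_shiftBy 1).aemeasurable
    ((M.map_shiftBy_law_absolutelyContinuous η η' hpos).ae_le
      ((ae_map_iff (measurable_shiftBy 1).aemeasurable hD).2 h))

lemma obs_eq_shiftBy {X : Type v} {Y : Type w} (n : ℕ) (ω : ℕ → X × Y) :
    obs n ω = fun i : Fin n => (shiftBy 1 ω i).2 := by
  ext i
  simp only [obs, shiftBy]
  rw [add_comm]

lemma ae_obs_of_ae_obs {θ : Θ} {η η' : Measure (X × Y)}
    [IsProbabilityMeasure η] [IsProbabilityMeasure η']
    (hpos : ∀ z, ∀ᵐ z' ∂(M.μ.prod M.ν), 0 < M.q θ z z') {n : ℕ} {D : Set (Fin n → Y)}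
    (hD : MeasurableSet D) (h : ∀ᵐ ω ∂M.law θ η, obs n ω ∈ D) :
    ∀ᵐ ω ∂M.law θ η', obs n ω ∈ D := by
  simp only [obs_eq_shiftBy] at h ⊢
  exact M.ae_shiftBy_of_ae_shiftBy hpos
    ((by fun_prop : Measurable fun (x : ℕ → X × Y) (i : Fin n) => (x i).2) hD) h

lemma map_obs (θ : Θ) (η : Measure (X × Y)) [IsProbabilityMeasure η] (n : ℕ) :
    (M.law θ η).map (obs n) = (Measure.pi fun _ => M.ν).withDensity (M.likelihood η θ) := by
  refine Measure.ext_of_lintegral _ fun F hF => ?_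
  rw [lintegral_map hF (measurable_obs n), M.lintegral_obs θ η hF,
    lintegral_withDensity_eq_lintegral_mul _ (M.measurable_likelihood η θ) hF]
  simp only [Pi.mul_apply, mul_comm]

lemma map_obs_absolutelyContinuous (θ : Θ) (η : Measure (X × Y)) [IsProbabilityMeasure η] (n : ℕ) :
    (M.law θ η).map (obs n) ≪ Measure.pi fun _ => M.ν := by
  rw [map_obs]; exact withDensity_absolutelyContinuous _ _

lemma lintegral_likelihood_pi (θ : Θ) (η : Measure (X × Y)) [IsProbabilityMeasure η] (n : ℕ) :
    ∫⁻ y, M.likelihood η θ y ∂Measure.pi (fun _ : Fin n => M.ν) = 1 := by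
  have := M.lintegral_obs θ η (n := n) (F := fun _ => 1) measurable_const
  simpa using this.symm

lemma ae_likelihood_ne_zero_self (θ : Θ) (η : Measure (X × Y)) [IsProbabilityMeasure η] (n : ℕ) :
    ∀ᵐ ω ∂M.law θ η, M.likelihood η θ (obs n ω) ≠ 0 := by
  refine ae_of_ae_map (p := fun y => M.likelihood η θ y ≠ 0) (measurable_obs n).aemeasurable ?_
  rw [map_obs, ae_withDensity_iff (M.measurable_likelihood η θ)]
  exact ae_of_all _ fun y h => h

/-- The integrated likelihood is almost surely finite. -/
lemma ae_lintegral_likelihood_lt_top (θ₀ : Θ) (η η' : Measure (X × Y)) [IsProbabilityMeasure η]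
    [IsProbabilityMeasure η'] (ρ : Measure Θ) [IsFiniteMeasure ρ] (n : ℕ) :
    ∀ᵐ ω ∂M.law θ₀ η', ∫⁻ θ, M.likelihood η θ (obs n ω) ∂ρ < ∞ := by
  refine ae_of_ae_map (p := fun y => ∫⁻ θ, M.likelihood η θ y ∂ρ < ∞)
    (measurable_obs n).aemeasurable ?_
  refine (M.map_obs_absolutelyContinuous θ₀ η' n).ae_le ?_
  refine ae_lt_top (M.measurable_lintegral_likelihood η ρ) ?_
  rw [lintegral_lintegral_swap]
  · simp [lintegral_likelihood_pi]
  · exact ((M.measurable_likelihood_joint η).comp measurable_swap).aemeasurable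

lemma lintegral_likelihood_dirac (η : Measure (X × Y)) [SFinite η] (θ : Θ) {n : ℕ}
    (y : Fin n → Y) : ∫⁻ θ', M.likelihood η θ' y ∂Measure.dirac θ = M.likelihood η θ y :=
  lintegral_dirac' θ ((M.measurable_likelihood_joint η).comp measurable_prodMk_right)

lemma ae_likelihood_lt_top (θ₀ θ : Θ) (η η' : Measure (X × Y)) [IsProbabilityMeasure η]
    [IsProbabilityMeasure η'] (n : ℕ) :
    ∀ᵐ ω ∂M.law θ₀ η', M.likelihood η θ (obs n ω) < ∞ := by
  have := M.ae_lintegral_likelihood_lt_top θ₀ η η' (Measure.dirac θ) n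
  simpa only [lintegral_likelihood_dirac] using this

/-- The density of the observations is almost surely nonzero under their own law, and the laws of
the observations for two initial distributions have the same null sets. -/
lemma ae_likelihood_ne_zero {θ : Θ} (η η' : Measure (X × Y)) [IsProbabilityMeasure η]
    [IsProbabilityMeasure η'] (hpos : ∀ z, ∀ᵐ z' ∂(M.μ.prod M.ν), 0 < M.q θ z z') (n : ℕ) :
    ∀ᵐ ω ∂M.law θ η', M.likelihood η θ (obs n ω) ≠ 0 :=
  M.ae_obs_of_ae_obs hpos (D := {y | M.likelihood η θ y ≠ 0})
    ((M.measurable_likelihood η θ (measurableSet_singleton 0)).compl)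
    (M.ae_likelihood_ne_zero_self θ η n)

lemma expectedKL_self (π : Measure (X × Y)) (θ : Θ) : M.expectedKL π θ θ = 0 := by
  simp [expectedKL]

/-- The initial law has no exponential effect on the likelihood at the true parameter. -/
lemma ae_eventually_likelihood_ge {π η : Measure (X × Y)} [IsProbabilityMeasure π]
    [IsProbabilityMeasure η] {θ₀ : Θ} (hπ : (M.Q θ₀).Invariant π)
    (hpos : ∀ θ z, ∀ᵐ z' ∂(M.μ.prod M.ν), 0 < M.q θ z z') {δ : ℝ} (hδ : 0 < δ) :
    ∀ᵐ ω ∂M.law θ₀ π, ∀ᶠ n : ℕ in atTop,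
      ENNReal.ofReal (Real.exp (-(δ * n))) * M.likelihood π θ₀ (obs n ω) ≤
        M.likelihood η θ₀ (obs n ω) := by
  -- A Dirac prior at `θ₀` charges every Kullback-Leibler neighbourhood, since the divergence
  -- vanishes there.
  have h := M.ae_eventually_lintegral_likelihood_ge (η := η) (ρ := Measure.dirac θ₀) hπ hpos
    (fun δ _ => by
      rw [Measure.dirac_apply_of_mem]
      · exact one_pos
      · simp [expectedKL_self]) hδ
  simpa only [lintegral_likelihood_dirac] using h

end FullyDominated

/-- From a lower bound on the likelihood ratio to the additive form on the logarithmic scale. -/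
lemma mul_log_add_le {a b : ℝ≥0∞} (ha : a ≠ 0) (ha' : a ≠ ∞) (hb : b ≠ 0) {c : ℝ} (hc : 0 ≤ c) :
    (c : EReal) * a.log + ((c * Real.log (min 1 (b / a)).toReal : ℝ) : EReal) ≤
      (c : EReal) * b.log := by
  -- The minimum with `1` keeps the correction term real when `b / a` is infinite.
  have hv0 : min 1 (b / a) ≠ 0 := (lt_min one_pos (ENNReal.div_pos hb ha')).ne'
  have hv1 : min 1 (b / a) ≠ ∞ := ne_top_of_le_ne_top ENNReal.one_ne_top (min_le_left _ _)
  have hle : a * min 1 (b / a) ≤ b :=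
    (mul_le_mul_right (min_le_right _ _) a).trans ENNReal.mul_div_le
  have h : (c : EReal) * a.log + ((c * Real.log (min 1 (b / a)).toReal : ℝ) : EReal) =
      (c : EReal) * (a * min 1 (b / a)).log := by
    rw [ENNReal.log_mul_add, ENNReal.log_pos_real ha ha', ENNReal.log_pos_real hv0 hv1]
    norm_cast
    ring_nf
  rw [h]
  exact mul_le_mul_of_nonneg_left (ENNReal.log_monotone hle) (by exact_mod_cast hc)

/-! ### Upper bound on the likelihood integrated away from the true parameter. -/

namespace FullyDominated

variable {Θ : Type u} {X : Type v} {Y : Type w}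
  [MeasurableSpace Θ] [MeasurableSpace X] [MeasurableSpace Y] (M : FullyDominated Θ X Y)

/-- The threshold `exp (-n / (k + 1)) p_{θ₀, π}(y)`. -/
noncomputable def threshold (π : Measure (X × Y)) (θ₀ : Θ) (n k : ℕ) (y : Fin n → Y) : ℝ≥0∞ :=
  ENNReal.ofReal (Real.exp (-(1 / ((k : ℝ) + 1) * n))) * M.likelihood π θ₀ y

lemma measurable_threshold (π : Measure (X × Y)) [SFinite π] (θ₀ : Θ) (n k : ℕ) :
    Measurable (M.threshold π θ₀ n k) :=
  (M.measurable_likelihood π θ₀).const_mul _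

/-- The observations for which the likelihood integrated over `C` exceeds the threshold. -/
def exceedance (η π : Measure (X × Y)) (θ₀ : Θ) (ρ : Measure Θ) (C : Set Θ) (n k : ℕ) :
    Set (Fin n → Y) :=
  {y | M.threshold π θ₀ n k y ≤ ∫⁻ θ in C, M.likelihood η θ y ∂ρ}

lemma measurableSet_exceedance (η π : Measure (X × Y)) [SFinite η] [SFinite π] (θ₀ : Θ)
    (ρ : Measure Θ) [SFinite ρ] (C : Set Θ) (n k : ℕ) :
    MeasurableSet (M.exceedance η π θ₀ ρ C n k) :=
  measurableSet_le (M.measurable_threshold π θ₀ n k) (M.measurable_lintegral_likelihood η _)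

/-- The pairs `(y, θ)` with `θ` in `C` whose likelihood nearly exceeds the threshold. -/
def nearMaximizers (η π : Measure (X × Y)) (θ₀ : Θ) (ρ : Measure Θ) (C : Set Θ) (n k : ℕ) :
    Set ((Fin n → Y) × Θ) :=
  {p | p.2 ∈ C ∧ M.threshold π θ₀ n k p.1 ≤ M.likelihood η p.2 p.1 * (ρ Set.univ + 1)}

lemma measurableSet_nearMaximizers (η π : Measure (X × Y)) [SFinite η] [SFinite π] (θ₀ : Θ)
    (ρ : Measure Θ) {C : Set Θ} (hC : MeasurableSet C) (n k : ℕ) :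
    MeasurableSet (M.nearMaximizers η π θ₀ ρ C n k) := by
  have h₁ := (M.measurable_threshold π θ₀ n k).comp
    (measurable_fst : Measurable (Prod.fst : (Fin n → Y) × Θ → Fin n → Y))
  have h₂ := ((M.measurable_likelihood_joint η (n := n)).comp measurable_swap).mul_const
    (ρ Set.univ + 1)
  exact (measurable_snd hC).inter (measurableSet_le h₁ h₂)

/-- Averaging: if almost every `θ ∈ C` had likelihood at most the threshold divided by `ρ(Θ) + 1`,
the integral over `C` would be strictly below the threshold. The added `1` gives strictness, and the
constant disappears on the scale `n⁻¹ log`. -/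
lemma measure_nearMaximizers_ne_zero {η π : Measure (X × Y)} [SFinite η] {θ₀ : Θ}
    {ρ : Measure Θ} [IsFiniteMeasure ρ] {C : Set Θ} (hC : MeasurableSet C) {n k : ℕ}
    {y : Fin n → Y} (h0 : M.likelihood π θ₀ y ≠ 0) (htop : M.likelihood π θ₀ y ≠ ∞)
    (hy : y ∈ M.exceedance η π θ₀ ρ C n k) :
    ρ (Prod.mk y ⁻¹' M.nearMaximizers η π θ₀ ρ C n k) ≠ 0 := by
  intro hnull
  have ht0 : M.threshold π θ₀ n k y ≠ 0 :=
    mul_ne_zero (ENNReal.ofReal_pos.2 (Real.exp_pos _)).ne' h0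
  have htt : M.threshold π θ₀ n k y ≠ ∞ := ENNReal.mul_ne_top ENNReal.ofReal_ne_top htop
  have hm : Measurable fun θ => M.likelihood η θ y :=
    (M.measurable_likelihood_joint η).comp measurable_prodMk_right
  have hlt : ∀ᵐ θ ∂ρ.restrict C,
      M.likelihood η θ y * (ρ Set.univ + 1) ≤ M.threshold π θ₀ n k y := by
    rw [ae_restrict_iff' hC]
    filter_upwards [measure_eq_zero_iff_ae_notMem.1 hnull] with θ hθ hθC
    by_contra! hcon
    exact hθ ⟨hθC, hcon.le⟩
  have hR : ρ Set.univ ≠ ∞ := measure_ne_top _ _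
  have h1 : M.threshold π θ₀ n k y * (ρ Set.univ + 1) ≤
      M.threshold π θ₀ n k y * ρ Set.univ := by
    calc _ ≤ (∫⁻ θ in C, M.likelihood η θ y ∂ρ) * (ρ Set.univ + 1) := by
          gcongr
          exact hy
      _ = ∫⁻ θ in C, M.likelihood η θ y * (ρ Set.univ + 1) ∂ρ := (lintegral_mul_const _ hm).symm
      _ ≤ ∫⁻ _ in C, M.threshold π θ₀ n k y ∂ρ := lintegral_mono_ae hlt
      _ = M.threshold π θ₀ n k y * ρ C := by simp
      _ ≤ _ := by gcongr; exact Set.subset_univ C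
  have h2 := (ENNReal.mul_le_mul_iff_right ht0 htt).1 h1
  exact absurd h2 (not_le.2 (ENNReal.lt_add_right hR one_ne_zero))

/-- If approximate maximum likelihood estimators are consistent, the likelihood integrated away
from the true parameter is exponentially small. -/
theorem ae_eventually_setLIntegral_likelihood_lt [TopologicalSpace Θ]
    {π η : Measure (X × Y)} [IsProbabilityMeasure π] [IsProbabilityMeasure η] {θ₀ : Θ}
    (hπ : (M.Q θ₀).Invariant π) (hpos : ∀ θ z, ∀ᵐ z' ∂(M.μ.prod M.ν), 0 < M.q θ z z')
    (hcons : M.ApproxMLEConsistent η π θ₀) (ρ : Measure Θ) [IsFiniteMeasure ρ] {C : Set Θ}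
    (hC : MeasurableSet C) (hCc : IsCompact C) (hCθ : Cᶜ ∈ 𝓝 θ₀) :
    ∀ᵐ ω ∂M.law θ₀ π, ∃ k : ℕ, ∀ᶠ n in atTop,
      ∫⁻ θ in C, M.likelihood η θ (obs n ω) ∂ρ < M.threshold π θ₀ n k (obs n ω) := by
  classical
  set A : (n : ℕ) → ℕ → Set (Fin n → Y) := M.exceedance η π θ₀ ρ C
  have hA : ∀ n k, MeasurableSet (A n k) := M.measurableSet_exceedance η π θ₀ ρ C
  have hsel := fun n k => exists_measurable_selection ((M.law θ₀ π).map (obs n)) ρ θ₀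
    (M.measurableSet_nearMaximizers η π θ₀ ρ hC n k)
  choose s hsm hsval hsae using hsel
  -- At an exceedance of the current level the estimator is a near-maximizer in `C`, up to a null
  -- set; otherwise it is `θ₀`.
  let τ : (n : ℕ) → (Fin n → Y) → Θ := fun n y =>
    if y ∈ A n (counter A n y) then s n (counter A n y) y else θ₀
  have hτm : ∀ n, Measurable (τ n) := fun n => by
    refine Measurable.ite (measurableSet_counter hA (measurable_counter hA n)) ?_ measurable_const
    have : Measurable fun p : ℕ × (Fin n → Y) => s n p.1 p.2 :=
      measurable_from_prod_countable_right fun k => hsm n k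
    exact this.comp ((measurable_counter hA n).prodMk measurable_id)
  let T : ℕ → (ℕ → X × Y) → Θ := fun n ω => τ n (obs n ω)
  have hR : ρ Set.univ + 1 ≠ ∞ := by finiteness
  have hcount : ∀ (n : ℕ) (ω : ℕ → X × Y), counter A (n + 1) (obs (n + 1) ω) =
      if obs n ω ∈ A n (counter A n (obs n ω)) then counter A n (obs n ω) + 1
      else counter A n (obs n ω) := fun n ω => rfl
  have hcmono : ∀ ω : ℕ → X × Y, Monotone fun n => counter A n (obs n ω) := fun ω =>
    monotone_nat_of_le_succ fun n => by
      rw [hcount]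
      split_ifs <;> omega
  have h0 : ∀ᵐ ω ∂M.law θ₀ π, ∀ n, M.likelihood π θ₀ (obs n ω) ≠ 0 :=
    ae_all_iff.2 fun n => M.ae_likelihood_ne_zero_self θ₀ π n
  have htop : ∀ᵐ ω ∂M.law θ₀ π, ∀ n, M.likelihood π θ₀ (obs n ω) < ∞ :=
    ae_all_iff.2 fun n => M.ae_likelihood_lt_top θ₀ θ₀ π π n
  have h0η : ∀ᵐ ω ∂M.law θ₀ π, ∀ n, M.likelihood η θ₀ (obs n ω) ≠ 0 :=
    ae_all_iff.2 fun n => M.ae_likelihood_ne_zero η π (hpos θ₀) n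
  have hmle : M.IsApproxMLE η π θ₀ (insert θ₀ C) T := by
    refine ⟨fun n _ ω => ?_, fun n _ => (hτm n).comp (comap_measurable _),
      fun n ω => (n : ℝ)⁻¹ * Real.log (min 1 (M.likelihood η (T n ω) (obs n ω) /
        M.likelihood π θ₀ (obs n ω))).toReal, ?_⟩
    · simp only [T, τ]
      split_ifs
      · rcases hsval n (counter A n (obs n ω)) (obs n ω) with h | h
        · rw [h]; exact Set.mem_insert _ _
        · exact Set.mem_insert_of_mem _ h.1
      · exact Set.mem_insert _ _
    · have hlow : ∀ᵐ ω ∂M.law θ₀ π, ∀ j : ℕ, ∀ᶠ n : ℕ in atTop,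
          M.threshold π θ₀ n j (obs n ω) ≤ M.likelihood η θ₀ (obs n ω) :=
        ae_all_iff.2 fun j => M.ae_eventually_likelihood_ge hπ hpos (by positivity)
      filter_upwards [h0, htop, h0η, hlow] with ω h0 htop h0η hlow
      have hTcases : ∀ n, T n ω = θ₀ ∨ (obs n ω ∈ A n (counter A n (obs n ω)) ∧
          M.threshold π θ₀ n (counter A n (obs n ω)) (obs n ω) ≤
            M.likelihood η (T n ω) (obs n ω) * (ρ Set.univ + 1)) := by
        intro n
        simp only [T, τ]
        split_ifs with h
        · rcases hsval n (counter A n (obs n ω)) (obs n ω) with h' | h'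
          · exact Or.inl h'
          · exact Or.inr ⟨h, h'.2⟩
        · exact Or.inl rfl
      have hT0 : ∀ n, M.likelihood η (T n ω) (obs n ω) ≠ 0 := by
        intro n
        rcases hTcases n with h | ⟨-, h⟩
        · rw [h]; exact h0η n
        · intro hz
          rw [hz, zero_mul, nonpos_iff_eq_zero] at h
          exact mul_ne_zero (ENNReal.ofReal_pos.2 (Real.exp_pos _)).ne' (h0 n) h
      refine ⟨fun n _ => mul_log_add_le (h0 n) (htop n).ne (hT0 n) (by positivity), ?_⟩
      have hTlow : ∀ j : ℕ, ∀ᶠ n : ℕ in atTop, M.threshold π θ₀ n j (obs n ω) ≤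
          M.likelihood η (T n ω) (obs n ω) * (ρ Set.univ + 1) := by
        intro j
        -- The counter is monotone and each exceedance raises it. So it passes `j`, after which the
        -- threshold in force is at least that of level `j`, or exceedances eventually stop, after
        -- which the estimator is `θ₀`.
        have hsplit : (∀ᶠ n in atTop, j ≤ counter A n (obs n ω)) ∨
            (∀ᶠ n in atTop, obs n ω ∉ A n (counter A n (obs n ω))) := by
          by_cases hj : ∃ N, j ≤ counter A N (obs N ω)
          · obtain ⟨N, hN⟩ := hj
            left
            filter_upwards [eventually_ge_atTop N] with n hn using hN.trans (hcmono ω hn)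
          · right
            push Not at hj
            by_contra hfreq
            have hfreq' : ∃ᶠ n in atTop, obs n ω ∈ A n (counter A n (obs n ω)) := by
              simpa [Filter.Frequently] using hfreq
            have hunb : ∀ i, ∃ N, i ≤ counter A N (obs N ω) := by
              intro i
              induction i with
              | zero => exact ⟨0, Nat.zero_le _⟩
              | succ i ih =>
                obtain ⟨N, hN⟩ := ih
                obtain ⟨n, hn, hmem⟩ := frequently_atTop.1 hfreq' N
                refine ⟨n + 1, ?_⟩
                rw [hcount, if_pos hmem]
                exact Nat.succ_le_succ (hN.trans (hcmono ω hn))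
            obtain ⟨N, hN⟩ := hunb j
            exact absurd (hj N) (not_lt.2 hN)
        filter_upwards [hlow j, hsplit.elim (fun h => h.mono fun n hn => Or.inl hn)
          (fun h => h.mono fun n hn => Or.inr hn) |> fun h : ∀ᶠ n in atTop,
            j ≤ counter A n (obs n ω) ∨ obs n ω ∉ A n (counter A n (obs n ω)) => h] with n h1 h2
        rcases hTcases n with h | ⟨hmem, h⟩
        · rw [h]
          exact h1.trans (le_mul_of_one_le_right zero_le le_add_self)
        · rcases h2 with h2 | h2
          · refine le_trans ?_ h
            unfold threshold
            gcongr
          · exact absurd hmem h2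
      rw [Metric.tendsto_atTop]
      intro e he
      -- Half of `e` pays for the rate `1 / (j + 1)`, the other half for the constant `ρ(Θ) + 1`.
      obtain ⟨j, hj⟩ := exists_nat_one_div_lt (half_pos he)
      have hlogR : ∀ᶠ n : ℕ in atTop, Real.log (ρ Set.univ + 1).toReal ≤ e / 2 * n := by
        obtain ⟨K, hK⟩ := exists_nat_ge (Real.log (ρ Set.univ + 1).toReal / (e / 2))
        filter_upwards [eventually_ge_atTop K] with n hn
        have : (K : ℝ) ≤ n := by exact_mod_cast hn
        rw [div_le_iff₀ (half_pos he)] at hK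
        nlinarith
      refine eventually_atTop.1 ?_
      filter_upwards [hTlow j, hlogR, eventually_ge_atTop 1] with n h1 h2 hn
      have hn0 : (0 : ℝ) < n := by exact_mod_cast hn
      set v := min 1 (M.likelihood η (T n ω) (obs n ω) / M.likelihood π θ₀ (obs n ω)) with hv
      have hv0 : v ≠ 0 := (lt_min one_pos (ENNReal.div_pos (hT0 n) (htop n).ne)).ne'
      have hvt : v ≠ ∞ := ne_top_of_le_ne_top ENNReal.one_ne_top (min_le_left _ _)
      have hv1 : v.toReal ≤ 1 := by
        simpa using ENNReal.toReal_mono ENNReal.one_ne_top (min_le_left 1 _ : v ≤ 1)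
      have hexp1 : ENNReal.ofReal (Real.exp (-(1 / ((j : ℝ) + 1) * n))) ≤ 1 := by
        rw [ENNReal.ofReal_le_one, Real.exp_le_one_iff, neg_nonpos]
        positivity
      have hge : ENNReal.ofReal (Real.exp (-(1 / ((j : ℝ) + 1) * n))) ≤ v * (ρ Set.univ + 1) := by
        rw [hv, min_mul_of_nonneg _ _ zero_le]
        refine le_min (hexp1.trans (by rw [one_mul]; exact le_add_self)) ?_
        rw [ENNReal.mul_comm_div, ← mul_div_assoc, ENNReal.le_div_iff_mul_le (Or.inl (h0 n))
          (Or.inl (htop n).ne)]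
        exact h1
      have hreal : Real.exp (-(1 / ((j : ℝ) + 1) * n)) ≤ v.toReal * (ρ Set.univ + 1).toReal := by
        rw [← ENNReal.toReal_mul, ← ENNReal.ofReal_le_iff_le_toReal (ENNReal.mul_ne_top hvt hR)]
        exact hge
      have hR0 : 0 < (ρ Set.univ + 1).toReal := ENNReal.toReal_pos (by simp) hR
      have hv0' : 0 < v.toReal := ENNReal.toReal_pos hv0 hvt
      have hlog := Real.log_le_log (Real.exp_pos _) hreal
      rw [Real.log_exp, Real.log_mul hv0'.ne' hR0.ne'] at hlog
      have hlogv : Real.log v.toReal ≤ 0 := Real.log_nonpos hv0'.le hv1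
      rw [Real.dist_eq, sub_zero, abs_of_nonpos (mul_nonpos_of_nonneg_of_nonpos (by positivity)
        hlogv), ← mul_neg, inv_mul_lt_iff₀ hn0]
      have := mul_lt_mul_of_pos_right hj hn0
      linarith
  have hlim := hcons _ (hCc.insert θ₀) (Set.mem_insert _ _) T hmle
  have hS : ∀ᵐ ω ∂M.law θ₀ π, ∀ n k,
      ρ (Prod.mk (obs n ω) ⁻¹' M.nearMaximizers η π θ₀ ρ C n k) ≠ 0 →
        (obs n ω, s n k (obs n ω)) ∈ M.nearMaximizers η π θ₀ ρ C n k :=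
    ae_all_iff.2 fun n => ae_all_iff.2 fun k =>
      ae_of_ae_map (measurable_obs n).aemeasurable (hsae n k)
  filter_upwards [hlim, hS, h0, htop] with ω hlim hS h0 htop
  obtain ⟨N, hN⟩ := eventually_atTop.1 (hlim.eventually hCθ)
  -- An exceedance would put the estimator in `C`, against its convergence to `θ₀`. So exceedances
  -- stop after `N`, the counter freezes, and its final value is the required `k`.
  have hnot : ∀ n ≥ N, obs n ω ∉ A n (counter A n (obs n ω)) := by
    intro n hn hmem
    have h := hS n _ (M.measure_nearMaximizers_ne_zero hC (h0 n) (htop n).ne hmem)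
    refine hN n hn ?_
    simp only [T, τ, if_pos hmem]
    exact h.1
  have hconst : ∀ n ≥ N, counter A n (obs n ω) = counter A N (obs N ω) := by
    intro n hn
    induction n, hn using Nat.le_induction with
    | base => rfl
    | succ n hn ih => rw [hcount, if_neg (hnot n hn), ih]
  refine ⟨counter A N (obs N ω), eventually_atTop.2 ⟨N, fun n hn => ?_⟩⟩
  have := hnot n hn
  rw [hconst n hn] at this
  exact not_le.1 this

end FullyDominated

/-! ### Weak convergence and asymptotics of the posterior. -/

/-- Convergence to a Dirac mass when the mass outside of neighbourhoods vanishes. -/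
lemma convergesWeakly_diracProba {Θ : Type u} [MetricSpace Θ] [MeasurableSpace Θ] [BorelSpace Θ]
    {ρ : ℕ → Measure Θ} {θ₀ : Θ} (hρ : ∀ᶠ n in atTop, IsProbabilityMeasure (ρ n))
    (h : ∀ j : ℕ, Tendsto (fun n => ρ n (Metric.ball θ₀ (1 / ((j : ℝ) + 1)))ᶜ) atTop (𝓝 0)) :
    ConvergesWeakly ρ (diracProba θ₀) := by
  have hex (n : ℕ) : ∃ σ : ProbabilityMeasure Θ,
      IsProbabilityMeasure (ρ n) → (σ : Measure Θ) = ρ n := by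
    by_cases hn : IsProbabilityMeasure (ρ n)
    · exact ⟨⟨ρ n, hn⟩, fun _ => rfl⟩
    · exact ⟨diracProba θ₀, fun h => absurd h hn⟩
  choose σ hσ using hex
  replace hσ : ∀ᶠ n in atTop, (σ n : Measure Θ) = ρ n := hρ.mono hσ
  -- Portmanteau theorem on open sets; only those containing `θ₀` require an argument.
  refine ⟨σ, hσ, tendsto_of_forall_isOpen_le_liminf_nat' fun G hG => ?_⟩
  by_cases hθ : θ₀ ∈ G
  · obtain ⟨r, hr, hball⟩ := Metric.isOpen_iff.1 hG θ₀ hθ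
    obtain ⟨j, hj⟩ := exists_nat_one_div_lt hr
    have hsub : Metric.ball θ₀ (1 / ((j : ℝ) + 1)) ⊆ G :=
      (Metric.ball_subset_ball hj.le).trans hball
    have hlim : Tendsto (fun n => 1 - ρ n (Metric.ball θ₀ (1 / ((j : ℝ) + 1)))ᶜ) atTop (𝓝 1) := by
      simpa using ENNReal.Tendsto.sub tendsto_const_nhds (h j) (Or.inl ENNReal.one_ne_top)
    refine (prob_le_one (μ := (diracProba θ₀ : Measure Θ))).trans ?_
    rw [← hlim.liminf_eq]
    refine liminf_le_liminf ?_
    filter_upwards [hσ] with n hn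
    rw [← hn, ← prob_compl_eq_one_sub Metric.isOpen_ball.measurableSet.compl, compl_compl]
    exact measure_mono hsub
  · have : (diracProba θ₀ : Measure Θ) G = 0 := by
      simp [diracProba, Measure.dirac_apply' _ hG.measurableSet, hθ]
    rw [this]
    exact zero_le

namespace FullyDominated

variable {Θ : Type u} {X : Type v} {Y : Type w}
  [MeasurableSpace Θ] [MeasurableSpace X] [MeasurableSpace Y] (M : FullyDominated Θ X Y)

lemma posterior_apply (prior : Measure Θ) (η : Measure (X × Y)) {n : ℕ} (y : Fin n → Y)
    {A : Set Θ} (hA : MeasurableSet A) :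
    M.posterior prior η y A =
      (∫⁻ θ, M.likelihood η θ y ∂prior)⁻¹ * ∫⁻ θ in A, M.likelihood η θ y ∂prior := by
  rw [posterior, Measure.smul_apply, smul_eq_mul, withDensity_apply _ hA]

lemma isProbabilityMeasure_posterior {prior : Measure Θ} {η : Measure (X × Y)} {n : ℕ}
    {y : Fin n → Y} (h0 : ∫⁻ θ, M.likelihood η θ y ∂prior ≠ 0)
    (htop : ∫⁻ θ, M.likelihood η θ y ∂prior ≠ ∞) :
    IsProbabilityMeasure (M.posterior prior η y) := by
  constructor
  rw [posterior_apply _ _ _ _ MeasurableSet.univ, Measure.restrict_univ,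
    ENNReal.inv_mul_cancel h0 htop]

lemma measurable_posterior_apply (prior : Measure Θ) [SFinite prior] (η : Measure (X × Y))
    [SFinite η] {n : ℕ} {A : Set Θ} (hA : MeasurableSet A) :
    Measurable fun y : Fin n → Y => M.posterior prior η y A := by
  simp_rw [M.posterior_apply _ _ _ hA]
  exact (M.measurable_lintegral_likelihood η prior).inv.mul
    (M.measurable_lintegral_likelihood η _)

/-- The posterior mass of a compact set which avoids a neighbourhood of the true parameter
vanishes asymptotically. -/
theorem ae_tendsto_posterior_apply [TopologicalSpace Θ]
    {π η : Measure (X × Y)} [IsProbabilityMeasure π] [IsProbabilityMeasure η] {θ₀ : Θ}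
    (hπ : (M.Q θ₀).Invariant π) (hpos : ∀ θ z, ∀ᵐ z' ∂(M.μ.prod M.ν), 0 < M.q θ z z')
    (hcons : M.ApproxMLEConsistent η π θ₀) {prior : Measure Θ} [IsFiniteMeasure prior]
    (hprior : ∀ δ : ℝ, 0 < δ → 0 < prior {θ | M.expectedKL π θ₀ θ ≤ ENNReal.ofReal δ}) {C : Set Θ}
    (hC : MeasurableSet C) (hCc : IsCompact C) (hCθ : Cᶜ ∈ 𝓝 θ₀) :
    ∀ᵐ ω ∂M.law θ₀ π, Tendsto (fun n => M.posterior prior η (obs n ω) C) atTop (𝓝 0) := by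
  -- The rate is half of the one in the upper bound on the numerator. It is required for all `k` at
  -- once, since the `k` of that bound depends on the trajectory.
  have hlow : ∀ᵐ ω ∂M.law θ₀ π, ∀ k : ℕ, ∀ᶠ n : ℕ in atTop,
      ENNReal.ofReal (Real.exp (-(1 / (2 * ((k : ℝ) + 1)) * n))) * M.likelihood π θ₀ (obs n ω) ≤
        ∫⁻ θ, M.likelihood η θ (obs n ω) ∂prior :=
    ae_all_iff.2 fun k => M.ae_eventually_lintegral_likelihood_ge hπ hpos hprior (by positivity)
  filter_upwards [M.ae_eventually_setLIntegral_likelihood_lt hπ hpos hcons prior hC hCc hCθ, hlow]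
    with ω ⟨k, hk⟩ hlow
  have hr : ENNReal.ofReal (Real.exp (-(1 / (2 * ((k : ℝ) + 1))))) < 1 := by
    rw [ENNReal.ofReal_lt_one, Real.exp_lt_one_iff, neg_lt_zero]
    positivity
  refine tendsto_of_tendsto_of_tendsto_of_le_of_le' tendsto_const_nhds
    (ENNReal.tendsto_pow_atTop_nhds_zero_of_lt_one hr) (Eventually.of_forall fun n => zero_le) ?_
  filter_upwards [hk, hlow k] with n h1 h2
  rw [M.posterior_apply _ _ _ hC, mul_comm, ← div_eq_mul_inv, ← ofReal_exp_neg_mul_nat]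
  refine ENNReal.div_le_of_le_mul (h1.le.trans ?_)
  have hsq : ENNReal.ofReal (Real.exp (-(1 / ((k : ℝ) + 1) * n))) =
      ENNReal.ofReal (Real.exp (-(1 / (2 * ((k : ℝ) + 1)) * n))) *
        ENNReal.ofReal (Real.exp (-(1 / (2 * ((k : ℝ) + 1)) * n))) := by
    rw [← ENNReal.ofReal_mul (Real.exp_pos _).le, ← Real.exp_add]
    congr 2
    field_simp
    ring
  rw [threshold, hsq, mul_assoc]
  gcongr

/-- The integrated likelihood is almost surely positive and finite from some rank on. -/
lemma ae_eventually_lintegral_likelihood_ne_zero {π η : Measure (X × Y)} [IsProbabilityMeasure π]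
    [IsProbabilityMeasure η] {θ₀ : Θ} (hπ : (M.Q θ₀).Invariant π)
    (hpos : ∀ θ z, ∀ᵐ z' ∂(M.μ.prod M.ν), 0 < M.q θ z z') {prior : Measure Θ}
    [IsFiniteMeasure prior]
    (hprior : ∀ δ : ℝ, 0 < δ → 0 < prior {θ | M.expectedKL π θ₀ θ ≤ ENNReal.ofReal δ}) :
    ∀ᵐ ω ∂M.law θ₀ π, ∀ᶠ n in atTop, ∫⁻ θ, M.likelihood η θ (obs n ω) ∂prior ≠ 0 ∧
      ∫⁻ θ, M.likelihood η θ (obs n ω) ∂prior ≠ ∞ := by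
  filter_upwards [M.ae_eventually_lintegral_likelihood_ge (η := η) hπ hpos hprior one_pos,
    ae_all_iff.2 fun n => M.ae_likelihood_ne_zero_self θ₀ π n,
    ae_all_iff.2 fun n => M.ae_lintegral_likelihood_lt_top θ₀ η π prior n] with ω h1 h2 h3
  filter_upwards [h1] with n h1
  refine ⟨fun h => ?_, (h3 n).ne⟩
  rw [h, nonpos_iff_eq_zero] at h1
  exact mul_ne_zero (ENNReal.ofReal_pos.2 (Real.exp_pos _)).ne' (h2 n) h1

end FullyDominated

end POMM

theorem mainTheorem1 {Θ X Y : Type*}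
    [MetricSpace Θ] [CompactSpace Θ] [MeasurableSpace Θ] [BorelSpace Θ]
    [MeasurableSpace X] [MeasurableSpace Y]
    (M : POMM.FullyDominated Θ X Y)
    (π : Θ → Measure (X × Y)) (θs : Θ)
    (prior : Measure Θ) [IsFiniteMeasure prior]
    (η : Measure (X × Y)) [IsProbabilityMeasure η]
    (hB1 : ∀ θ, POMM.IsUniqueStationaryLaw (M.Q θ) (π θ))
    (hB2 : M.ApproxMLEConsistent η (π θs) θs)
    (hB3 : ∀ θ z, ∀ᵐ z' ∂(M.μ.prod M.ν), 0 < M.q θ z z')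
    (hB4 : ∀ δ : ℝ, 0 < δ → 0 < prior {θ | M.expectedKL (π θs) θs θ ≤ ENNReal.ofReal δ})
    (ηs : Measure (X × Y)) [IsProbabilityMeasure ηs] :
    ∀ᵐ ω ∂(M.law θs ηs),
      POMM.ConvergesWeakly (fun n => M.posterior prior η (POMM.obs n ω))
        (diracProba θs) := by
  have : IsProbabilityMeasure (π θs) := (hB1 θs).1
  have hπ : (M.Q θs).Invariant (π θs) := (hB1 θs).2.1
  let C : ℕ → Set Θ := fun j => (Metric.ball θs (1 / ((j : ℝ) + 1)))ᶜ
  have hC : ∀ j, MeasurableSet (C j) := fun j => Metric.isOpen_ball.measurableSet.compl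
  have hobs : ∀ n, Measurable fun (x : ℕ → X × Y) (i : Fin n) => (x i).2 := fun n => by fun_prop
  -- Well-definedness of the posterior and, in `D₂`, vanishing mass outside countably many balls are
  -- expressed as measurable events of the trajectory from time `1`, so that they transfer from the
  -- stationary law to `ηs`.
  let D₁ : Set (ℕ → X × Y) := ⋃ N, ⋂ n ≥ N, {x |
    ∫⁻ θ, M.likelihood η θ (fun i : Fin n => (x i).2) ∂prior ≠ 0 ∧
      ∫⁻ θ, M.likelihood η θ (fun i : Fin n => (x i).2) ∂prior ≠ ∞}
  have hD₁ : MeasurableSet D₁ := by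
    refine MeasurableSet.iUnion fun N => MeasurableSet.iInter fun n => MeasurableSet.iInter fun _ =>
      ?_
    have hm := (M.measurable_lintegral_likelihood η prior).comp (hobs n)
    exact (hm (measurableSet_singleton 0)).compl.inter (hm (measurableSet_singleton ∞)).compl
  let D₂ : ℕ → Set (ℕ → X × Y) := fun j => {x | Tendsto (fun n =>
    M.posterior prior η (fun i : Fin n => (x i).2) (C j)) atTop (𝓝 0)}
  have hD₂ : ∀ j, MeasurableSet (D₂ j) := fun j => measurableSet_tendsto _ fun n =>
    (M.measurable_posterior_apply prior η (hC j)).comp (hobs n)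
  have h₁ : ∀ᵐ ω ∂M.law θs ηs, POMM.shiftBy 1 ω ∈ D₁ := by
    refine M.ae_shiftBy_of_ae_shiftBy (η := π θs) (hB3 θs) hD₁ ?_
    filter_upwards [M.ae_eventually_lintegral_likelihood_ne_zero (η := η) hπ hB3 hB4] with ω hω
    obtain ⟨N, hN⟩ := eventually_atTop.1 hω
    refine Set.mem_iUnion.2 ⟨N, Set.mem_iInter₂.2 fun n hn => ?_⟩
    have := hN n hn
    rwa [POMM.FullyDominated.obs_eq_shiftBy] at this
  have h₂ : ∀ᵐ ω ∂M.law θs ηs, ∀ j, POMM.shiftBy 1 ω ∈ D₂ j := by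
    refine ae_all_iff.2 fun j => ?_
    refine M.ae_shiftBy_of_ae_shiftBy (η := π θs) (hB3 θs) (hD₂ j) ?_
    have hCj : (C j)ᶜ ∈ 𝓝 θs := by
      simp only [C, compl_compl]
      exact Metric.ball_mem_nhds _ (by positivity)
    -- Compactness of `Θ` makes the complement of the open ball compact, so (B2) applies to it with
    -- `θs` added.
    filter_upwards [M.ae_tendsto_posterior_apply hπ hB3 hB2 hB4 (hC j)
      Metric.isOpen_ball.isClosed_compl.isCompact hCj] with ω hω
    simp only [POMM.FullyDominated.obs_eq_shiftBy] at hω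
    exact hω
  filter_upwards [h₁, h₂] with ω hω₁ hω₂
  refine POMM.convergesWeakly_diracProba ?_ fun j => ?_
  · obtain ⟨N, hN⟩ := Set.mem_iUnion.1 hω₁
    filter_upwards [eventually_ge_atTop N] with n hn
    have h := Set.mem_iInter₂.1 hN n hn
    rw [POMM.FullyDominated.obs_eq_shiftBy]
    exact M.isProbabilityMeasure_posterior h.1 h.2
  · simp only [POMM.FullyDominated.obs_eq_shiftBy]
    exact hω₂ j
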